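/- **Setting.** Let $(\Lambda,d_\Lambda)$ be a bounded metric space with a finite Borel measure $\rho$. A nonsingular measurable map $T:\Lambda\to\Lambda$ is *nonuniformly expanding* with constants $\beta>1$, $C_1\ge1$, $\eta\in(0,1]$ if there are a measurable set $Y\subset\Lambda$ with $\rho(Y)>0$, an at most countable measurable partition $\alpha$ of $Y$ (modulo a $\rho$-null set) and a $\rho$-integrable return time $\tau:Y\to\{1,2,\dots\}$, constant on each $a\in\alpha$ with value $\tau(a)$, such that, with $F=T^\tau$, for each $a\in\alpha$: 1. $F$ restricts to a bijection from $a$ onto $Y$, modulo $\rho$-null sets; 2. $d_\Lambda(Fx,Fy)\ge\beta\, d_\Lambda(x,y)$ for all $x,y\in a$; 3. $d_\Lambda(T^\ell x,T^\ell y)\le C_1 d_\Lambda(Fx,Fy)$ for all $x,y\in a$, $0\le\ell<\tau(a)$; 4. $\zeta_0=\frac{d\rho|_Y}{d\rho|_Y\circ F}$ has a positive version with $|\log\zeta_0(x)-\log\zeta_0(y)|\le C_1d_\Lambda(Fx,Fy)^\eta$ for all $x,y\in a$. Let $\mu_Y$ be the (unique) $F$-invariant probability measure on $Y$ with $\mu_Y\ll\rho|_Y$.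 On the tower $\Delta=\{(y,\ell): y\in Y,\ 0\le\ell\le\tau(y)-1\}$ put $\mu_\Delta=(\mu_Y\times\text{counting})/\int_Y\tau\,d\mu_Y$, and let $\mu=(\pi_\Delta)_*\mu_\Delta$ with $\pi_\Delta(y,\ell)=T^\ell y$; this is an absolutely continuous ergodic $T$-invariant Borel probability measure on $\Lambda$. Let $p>2$ and let $T_n:\Lambda\to\Lambda$, $n\in\mathbb N\cup\{\infty\}$, be a *uniform family of order $p$* of such maps: each $T_n$ is nonuniformly expanding on $(\Lambda,\rho)$ with its own $Y_n,\alpha_n,\tau_n,\mu_{Y_n},\mu_n$, the constants $\beta,C_1,\eta$ are independent of $n$, and $$\sup_n\int_{Y_n}\tau_n^p\,1_{\{\tau_n\ge q\}}\,d\mu_{Y_n}\to0\quad\text{as } q\to\infty .$$ Write $\|v\|_\eta=\sup_\Lambda|v|+\sup_{x\ne y}|v(x)-v(y)|/d_\Lambda(x,y)^\eta$, and let $C^\eta$ be the functions with $\|v\|_\eta<\infty$. Assume that $\mu_n\to\mu_\infty$ weakly (statistical stability) and that, as $n\to\infty$, for all $j,k\ge0$ and all $v,w\in C^\eta(\Lambda,\mathbb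 R)$, $$\int_\Lambda (v\circ T_\infty^j)(w\circ T_\infty^k)\,d\mu_n\to\int_\Lambda (v\circ T_\infty^j)(w\circ T_\infty^k)\,d\mu_\infty,$$ $$\mu_n\{y\in\Lambda: d_\Lambda(T_n^jy,T_\infty^jy)>a\}\to0\quad\text{for all } a>0 .$$ Let $v_n\in C^\eta(\Lambda,\mathbb R^d)$, $n\in\mathbb N\cup\{\infty\}$, with $\int_\Lambda v_n\,d\mu_n=0$ and $\lim_{n\to\infty}\|v_n-v_\infty\|_\eta=0$. For $k\ge1$ define, with $a\otimes b=ab^T$, $$S_kv_n=\sum_{0\le j<k}v_n\circ T_n^j,\qquad \mathbb S_kv_n=\sum_{0\le i<j<k}(v_n\circ T_n^i)\otimes(v_n\circ T_n^j).$$ **Statement.** For every $n\in\mathbb N\cup\{\infty\}$ the limits $$\Sigma_n=\lim_{k\to\infty}\frac1k\int_\Lambda S_kv_n\otimes S_kv_n\,d\mu_n,\qquad E_n=\lim_{k\to\infty}\frac1k\int_\Lambda\mathbb S_kv_n\,d\mu_n$$ exist in $\mathbb R^{d\times d}$, and $\lim_{n\to\infty}\Sigma_n=\Sigma_\infty$,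 $\lim_{n\to\infty}E_n=E_\infty$. -/

import Mathlib

open Set Filter MeasureTheory
open scoped Topology NNReal ENNReal

noncomputable section

namespace NonuniformlyExpanding

/-! ### Hölder observables and outer products -/

/-- The Hölder norm `‖v‖_η = sup |v| + sup_{x ≠ y} |v x - v y| / d(x, y) ^ η`,
with values in `[0, ∞]`. -/
def holderNorm {Λ E : Type*} [MetricSpace Λ] [NormedAddCommGroup E]
    (η : ℝ≥0) (v : Λ → E) : ℝ≥0∞ :=
  (⨆ x, ‖v x‖ₑ) + eHolderNorm η v

/-- `v ∈ C^η`. -/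
def IsHolder {Λ E : Type*} [MetricSpace Λ] [NormedAddCommGroup E]
    (η : ℝ≥0) (v : Λ → E) : Prop :=
  holderNorm η v < ∞

/-- The outer product `a ⊗ b = a bᵀ`. -/
def outer {d : ℕ} (a b : EuclideanSpace ℝ (Fin d)) : Matrix (Fin d) (Fin d) ℝ :=
  Matrix.of fun r s => a r * b s

/-- The (entrywise) integral of a matrix-valued function. -/
def matrixIntegral {Λ : Type*} [MeasurableSpace Λ] {d : ℕ} (μ : Measure Λ)
    (M : Λ → Matrix (Fin d) (Fin d) ℝ) : Matrix (Fin d) (Fin d) ℝ :=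
  Matrix.of fun r s => ∫ x, M x r s ∂μ

/-- The iterated Birkhoff sum `∑_{0 ≤ i < j < k} (v ∘ T^i) ⊗ (v ∘ T^j)`. -/
def iteratedSum {Λ : Type*} {d : ℕ} (T : Λ → Λ) (v : Λ → EuclideanSpace ℝ (Fin d))
    (k : ℕ) (x : Λ) : Matrix (Fin d) (Fin d) ℝ :=
  ∑ j ∈ Finset.range k, ∑ i ∈ Finset.range j, outer (v (T^[i] x)) (v (T^[j] x))

/-- `k⁻¹ ∫ S_k v ⊗ S_k v dμ`, where `S_k v = ∑_{0 ≤ j < k} v ∘ T^j`. -/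
def meanSquare {Λ : Type*} [MeasurableSpace Λ] {d : ℕ} (μ : Measure Λ) (T : Λ → Λ)
    (v : Λ → EuclideanSpace ℝ (Fin d)) (k : ℕ) : Matrix (Fin d) (Fin d) ℝ :=
  (k : ℝ)⁻¹ • matrixIntegral μ fun x => outer (birkhoffSum T v k x) (birkhoffSum T v k x)

/-- `k⁻¹ ∫ 𝕊_k v dμ`, where `𝕊_k v` is the iterated Birkhoff sum. -/
def meanIterated {Λ : Type*} [MeasurableSpace Λ] {d : ℕ} (μ : Measure Λ) (T : Λ → Λ)
    (v : Λ → EuclideanSpace ℝ (Fin d)) (k : ℕ) : Matrix (Fin d) (Fin d) ℝ :=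
  (k : ℝ)⁻¹ • matrixIntegral μ (iteratedSum T v k)

/-! ### Nonuniformly expanding maps -/

/-- An inducing scheme: the base `Y`, its partition `α` and the return time `τ`
(only the values of `τ` on `Y` matter). -/
structure InducingScheme (Λ : Type*) where
  /-- the base `Y` -/
  Y : Set Λ
  /-- the partition `α` of `Y` -/
  α : Set (Set Λ)
  /-- the return time `τ` -/
  τ : Λ → ℕ

/-- The induced map `F = T^τ`. -/
def InducingScheme.induced {Λ : Type*} (I : InducingScheme Λ) (T : Λ → Λ) (y : Λ) : Λ :=
  T^[I.τ y] y

/-- `F` restricts to a bijection from `a` onto `b` after null sets are discarded from `a` and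
from `b`. (Where this is used, `F` is measurable and expands distances on `a`, so the inverse is
Lipschitz, hence measurable.) -/
def BijOnModNull {Λ : Type*} [MeasurableSpace Λ] (ρ : Measure Λ) (F : Λ → Λ)
    (a b : Set Λ) : Prop :=
  ∃ a' ⊆ a, ∃ b' ⊆ b, MeasurableSet a' ∧ MeasurableSet b' ∧
    ρ (a \ a') = 0 ∧ ρ (b \ b') = 0 ∧ BijOn F a' b'

/-- `T` is a nonuniformly expanding map of `(Λ, ρ)`, with inducing scheme `I` and constants
`β > 1`, `C₁ ≥ 1`, `η ∈ (0, 1]`. -/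
structure IsNonuniformlyExpanding {Λ : Type*} [MetricSpace Λ] [MeasurableSpace Λ]
    (ρ : Measure Λ) (T : Λ → Λ) (I : InducingScheme Λ) (β C₁ : ℝ) (η : ℝ≥0) : Prop where
  one_lt_β : 1 < β
  one_le_C₁ : 1 ≤ C₁
  η_pos : 0 < η
  η_le_one : η ≤ 1
  /-- `T` is measurable and `ρ A = 0` implies `ρ (T⁻¹ A) = 0`. -/
  nonsingular : Measure.QuasiMeasurePreserving T ρ ρ
  measurableSet_Y : MeasurableSet I.Y
  measure_Y_pos : 0 < ρ I.Y
  /-- `α` is an at most countable measurable partition of `Y`, modulo a null set. -/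
  countable_α : I.α.Countable
  measurableSet_α : ∀ a ∈ I.α, MeasurableSet a
  subset_Y : ∀ a ∈ I.α, a ⊆ I.Y
  disjoint_α : I.α.PairwiseDisjoint id
  cover_Y : ρ (I.Y \ ⋃₀ I.α) = 0
  /-- `τ` is an integrable function with values `≥ 1`, constant on each partition element. -/
  measurable_τ : Measurable I.τ
  one_le_τ : ∀ y ∈ I.Y, 1 ≤ I.τ y
  τ_const : ∀ a ∈ I.α, ∀ x ∈ a, ∀ y ∈ a, I.τ x = I.τ y
  integrable_τ : IntegrableOn (fun y => (I.τ y : ℝ)) I.Y ρ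
  /-- (1) `F` is a bijection from `a` onto `Y`, in the measure-theoretic sense. -/
  bijection : ∀ a ∈ I.α, BijOnModNull ρ (I.induced T) a I.Y
  /-- (2) -/
  expansion : ∀ a ∈ I.α, ∀ x ∈ a, ∀ y ∈ a,
    β * dist x y ≤ dist (I.induced T x) (I.induced T y)
  /-- (3) -/
  intermediate : ∀ a ∈ I.α, ∀ x ∈ a, ∀ y ∈ a, ∀ l < I.τ x,
    dist (T^[l] x) (T^[l] y) ≤ C₁ * dist (I.induced T x) (I.induced T y)
  /-- (4) There is a positive version `ζ₀` of `dρ|_Y / d(ρ|_Y ∘ F)`, that is, of the reciprocal of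
  the density with respect to `ρ` of the measure `S ↦ ρ (Y ∩ F S)` on each partition element,
  whose logarithm satisfies the distortion bound. -/
  distortion : ∃ ζ₀ : Λ → ℝ, Measurable ζ₀ ∧
    ∀ a ∈ I.α, (∀ x ∈ a, 0 < ζ₀ x) ∧
      (∀ S ⊆ a, MeasurableSet S →
        ρ (I.Y ∩ I.induced T '' S) = ∫⁻ x in S, ENNReal.ofReal (ζ₀ x)⁻¹ ∂ρ) ∧
      ∀ x ∈ a, ∀ y ∈ a, |Real.log (ζ₀ x) - Real.log (ζ₀ y)| ≤
        C₁ * dist (I.induced T x) (I.induced T y) ^ (η : ℝ)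

/-- `ν` is an absolutely continuous `F`-invariant probability measure on `Y`, `F = T^τ`.
(For a nonuniformly expanding map there is exactly one.) -/
structure IsInducedMeasure {Λ : Type*} [MeasurableSpace Λ] (ρ : Measure Λ) (T : Λ → Λ)
    (I : InducingScheme Λ) (ν : Measure Λ) : Prop where
  isProbabilityMeasure : IsProbabilityMeasure ν
  absolutelyContinuous : ν ≪ ρ.restrict I.Y
  invariant : MeasurePreserving (I.induced T) ν ν

/-- The Young tower `Δ = {(y, ℓ) : y ∈ Y, 0 ≤ ℓ ≤ τ y - 1}`. -/
def InducingScheme.tower {Λ : Type*} (I : InducingScheme Λ) : Set (Λ × ℕ) :=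
  {z | z.1 ∈ I.Y ∧ z.2 < I.τ z.1}

/-- The measure `μ_Δ = ν × counting / ∫ τ dν` on the tower. -/
def InducingScheme.towerMeasure {Λ : Type*} [MeasurableSpace Λ] (I : InducingScheme Λ)
    (ν : Measure Λ) : Measure (Λ × ℕ) :=
  (∫⁻ y, (I.τ y : ℝ≥0∞) ∂ν)⁻¹ • (ν.prod Measure.count).restrict I.tower

/-- The `T`-invariant measure `μ = (π_Δ)_* μ_Δ`, where `π_Δ (y, ℓ) = T^ℓ y`. -/
def InducingScheme.projectedMeasure {Λ : Type*} [MeasurableSpace Λ] (I : InducingScheme Λ)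
    (T : Λ → Λ) (ν : Measure Λ) : Measure Λ :=
  (I.towerMeasure ν).map fun z => T^[z.2] z.1

/-- `T n`, `n ∈ ι`, is a uniform family of order `p` of nonuniformly expanding maps of `(Λ, ρ)`,
with inducing schemes `I n`, measures `μY n` on the bases invariant under the induced maps, and
corresponding `T n`-invariant measures `μ n`; the Hölder exponent in the distortion bound
is `η`. -/
structure IsUniformFamily {Λ ι : Type*} [MetricSpace Λ] [MeasurableSpace Λ]
    (ρ : Measure Λ) (T : ι → Λ → Λ) (I : ι → InducingScheme Λ) (μY μ : ι → Measure Λ)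
    (η : ℝ≥0) (p : ℝ) : Prop where
  /-- The constants can be chosen independent of `n`. -/
  expanding : ∃ β C₁ : ℝ, ∀ n, IsNonuniformlyExpanding ρ (T n) (I n) β C₁ η
  inducedMeasure : ∀ n, IsInducedMeasure ρ (T n) (I n) (μY n)
  measure_eq : ∀ n, μ n = (I n).projectedMeasure (T n) (μY n)
  /-- The family `τ_n ^ p` is uniformly integrable. -/
  uniformIntegrable : Tendsto
    (fun q : ℝ => ⨆ n, ∫⁻ y in {y | q ≤ ((I n).τ y : ℝ)}, ((I n).τ y : ℝ≥0∞) ^ p ∂(μY n))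
    atTop (𝓝 0)

end NonuniformlyExpanding

end

/-! The plan is to express both limits through one linear functional on the tower, with an error
bound uniform over the family, and then to interchange the limits in `k` and `n`.

Decay for the induced map. `F = T^τ` has countably many full branches that contract and have
log-Hölder weights. Its transfer operator maps a cone of log-Hölder functions into a strictly
smaller one, so a fixed fraction of each image can be split off as a constant
(`FullBranches.exists_split`). Two functions of equal integral share these constants, and their
difference decays geometrically (`FullBranches.decay`). The test function enters only through its
`L¹` norm, which matters because induced observables are as unbounded as `τ`. The rate depends only
on `β`, `C₁`, `η` and the diameter (`exists_lintegral_decay`, `exists_decay`).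

The Green-Kubo functional. Let `B` be the induced observable of `v` and `P` the transfer operator of
`F` with respect to the invariant measure on `Y`. Formally put `χ(y, ℓ) = ∑_{k ≥ 1} P^k B (y) + S_ℓ
v (y)` on the tower. Only the pairing `greenKubo v b = ∫ χ b dμ_Δ` is needed, and `χ` itself is
never constructed. Summation by parts and telescoping give `∫ v · b ∘ T dμ = greenKubo v b -
greenKubo v (b ∘ T)` (`TowerData.integral_mul_comp`). Summing this over `i < j < k` gives `k ·
greenKubo v b - greenKubo v (S_k b)` (`TowerData.sum_integral_eq`). Hence `E_n` should have the
entries `greenKubo v^r v^s`, with error `greenKubo v (S_k b) / k`.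

The error. `TowerData.abs_greenKubo_le` bounds `greenKubo v f` by a multiple of `‖f‖₁` plus `‖f‖_∞`
times the tail of `∫ τ²`. For `f = S_k b` the first norm is `O(√k)`
(`TowerData.integral_abs_birkhoffSum_le`) and the second is `O(k)`. After division by `k`, a large
cutoff `q` makes the tail small uniformly in `n`, and then a large `k` makes the rest small
(`IsUniformFamily.exists_uniform_rate`).

The limit in `n`. For fixed `k` the averages are finite sums of correlations, which converge by the
hypotheses on `T_n`, `μ_n` and `v_n` (`tendsto_integral_corr`). Uniformity in `n` then gives `E_n →
E_∞` (`tendsto_of_uniform_approx`). Finally `Σ_n = ∫ v_n ⊗ v_n dμ_n + E_n + E_nᵀ`. -/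

noncomputable section

namespace NonuniformlyExpanding

/-! ### Log-Hölder functions -/

/-- `f x ≤ exp (R d(x, y) ^ η) f y` for all `x, y ∈ G`. -/
def LogHolder {Λ : Type*} [MetricSpace Λ] (G : Set Λ) (η : ℝ≥0) (R : ℝ) (f : Λ → ℝ≥0∞) : Prop :=
  ∀ x ∈ G, ∀ y ∈ G, f x ≤ ENNReal.ofReal (Real.exp (R * dist x y ^ (η : ℝ))) * f y

section LogHolder

variable {Λ : Type*} [MetricSpace Λ] {G : Set Λ} {η : ℝ≥0} {R R' D : ℝ} {f g : Λ → ℝ≥0∞}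

lemma LogHolder.mono (hf : LogHolder G η R f) (h : R ≤ R') : LogHolder G η R' f :=
  fun x hx y hy => (hf x hx y hy).trans (by gcongr)

lemma LogHolder.mono_set {G' : Set Λ} (hf : LogHolder G η R f) (h : G' ⊆ G) :
    LogHolder G' η R f :=
  fun x hx y hy => hf x (h hx) y (h hy)

lemma LogHolder.add (hf : LogHolder G η R f) (hg : LogHolder G η R g) :
    LogHolder G η R (fun x => f x + g x) := fun x hx y hy => by
  rw [mul_add]
  exact add_le_add (hf x hx y hy) (hg x hx y hy)

lemma LogHolder.mul (hf : LogHolder G η R f) (hg : LogHolder G η R' g) :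
    LogHolder G η (R + R') (fun x => f x * g x) := fun x hx y hy => by
  rw [add_mul, Real.exp_add, ENNReal.ofReal_mul (Real.exp_pos _).le, mul_mul_mul_comm]
  exact mul_le_mul' (hf x hx y hy) (hg x hx y hy)

lemma LogHolder.const_mul (c : ℝ≥0∞) (hf : LogHolder G η R f) :
    LogHolder G η R (fun x => c * f x) := fun x hx y hy => by
  rw [mul_left_comm]
  exact mul_le_mul_right (hf x hx y hy) c

lemma LogHolder.limsup {u : ℕ → Λ → ℝ≥0∞} (hu : ∀ n, LogHolder G η R (u n)) :
    LogHolder G η R (fun x => limsup (fun n => u n x) atTop) := fun x hx y hy => by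
  rw [← ENNReal.limsup_const_mul_of_ne_top ENNReal.ofReal_ne_top]
  exact limsup_le_limsup (.of_forall fun n => hu n x hx y hy)

lemma LogHolder.le_of_dist_le (hf : LogHolder G η R f) (hR : 0 ≤ R) {x y : Λ} (hx : x ∈ G)
    (hy : y ∈ G) (hD : dist x y ^ (η : ℝ) ≤ D) :
    f x ≤ ENNReal.ofReal (Real.exp (R * D)) * f y :=
  (hf x hx y hy).trans (by gcongr)

variable [MeasurableSpace Λ] {m : Measure Λ}

lemma LogHolder.mul_measure_le (hf : LogHolder G η R f) (hR : 0 ≤ R)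
    (hD : ∀ x y : Λ, dist x y ^ (η : ℝ) ≤ D) (hG : ∀ᵐ y ∂m, y ∈ G) {x : Λ} (hx : x ∈ G) :
    f x * m univ ≤ ENNReal.ofReal (Real.exp (R * D)) * ∫⁻ y, f y ∂m := by
  rw [← lintegral_const_mul' _ _ ENNReal.ofReal_ne_top, ← lintegral_const]
  refine lintegral_mono_ae ?_
  filter_upwards [hG] with y hy using hf.le_of_dist_le hR hx hy (hD x y)

lemma LogHolder.lintegral_le (hf : LogHolder G η R f) (hR : 0 ≤ R)
    (hD : ∀ x y : Λ, dist x y ^ (η : ℝ) ≤ D) (hG : ∀ᵐ y ∂m, y ∈ G) {x : Λ} (hx : x ∈ G) :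
    ∫⁻ y, f y ∂m ≤ ENNReal.ofReal (Real.exp (R * D)) * f x * m univ := by
  rw [← lintegral_const]
  refine lintegral_mono_ae ?_
  filter_upwards [hG] with y hy using hf.le_of_dist_le hR hy hx (hD y x)

end LogHolder

/-- Convexity of `exp` at `R' t`, a convex combination of `R t` and `0`. -/
lemma mul_exp_sub_one_le {R R' t : ℝ} (hR' : 0 ≤ R') (h : R' < R) :
    (1 - R' / R) * (Real.exp (R * t) - 1) ≤ Real.exp (R * t) - Real.exp (R' * t) := by
  have hR : 0 < R := hR'.trans_lt h
  have := convexOn_exp.2 (mem_univ (R * t)) (mem_univ 0) (div_nonneg hR' hR.le)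
    (sub_nonneg.2 ((div_le_one hR).2 h.le)) (by ring)
  simp only [smul_eq_mul, mul_zero, add_zero, Real.exp_zero, mul_one] at this
  rw [show R' / R * (R * t) = R' * t by field_simp] at this
  linarith

/-- The room between the cones `R' < R` pays for subtracting a constant. With `t = d(x, y)^η` it
suffices that `(exp (R t) - 1) c ≤ (exp (R t) - exp (R' t)) f y`, which is `mul_exp_sub_one_le`
combined with the bound on `c`. -/
lemma LogHolder.tsub_const {Λ : Type*} [MetricSpace Λ] {G : Set Λ} {η : ℝ≥0} {R R' : ℝ}
    {f : Λ → ℝ≥0∞} (hf : LogHolder G η R' f) (hR' : 0 ≤ R') (h : R' < R) {c : ℝ≥0∞} (hc : c ≠ ∞)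
    (hcf : ∀ x ∈ G, c ≤ ENNReal.ofReal (1 - R' / R) * f x) :
    LogHolder G η R (fun x => f x - c) := fun x hx y hy => by
  set t := dist x y ^ (η : ℝ)
  have ht : 0 ≤ t := by positivity
  have hR : 0 < R := hR'.trans_lt h
  rcases eq_or_ne (f y) ∞ with hy' | hy'
  · simp only [hy', ENNReal.top_sub hc]
    rw [ENNReal.mul_top (by simp [Real.exp_pos])]
    exact le_top
  refine (tsub_le_tsub_right (hf x hx y hy) c).trans ?_
  lift f y to ℝ≥0 using hy' with a ha
  lift c to ℝ≥0 using hc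
  have h1 := hcf y hy
  rw [← ha, ENNReal.ofReal, ← ENNReal.coe_mul, ENNReal.coe_le_coe, ← NNReal.coe_le_coe,
    NNReal.coe_mul, Real.coe_toNNReal _ (sub_nonneg.2 ((div_le_one hR).2 h.le))] at h1
  have hE := mul_exp_sub_one_le (t := t) hR' h
  have hE1 : 1 ≤ Real.exp (R * t) := Real.one_le_exp (by positivity)
  have hca : (c : ℝ) ≤ a := h1.trans (mul_le_of_le_one_left a.2
    (sub_le_self _ (div_nonneg hR' hR.le)))
  rw [← ENNReal.coe_sub, ENNReal.ofReal, ENNReal.ofReal, ← ENNReal.coe_mul, ← ENNReal.coe_mul,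
    ← ENNReal.coe_sub, ENNReal.coe_le_coe, tsub_le_iff_right, ← NNReal.coe_le_coe]
  push_cast [NNReal.coe_sub (show c ≤ a from hca)]
  rw [Real.coe_toNNReal _ (Real.exp_pos _).le, Real.coe_toNNReal _ (Real.exp_pos _).le]
  nlinarith [mul_le_mul_of_nonneg_right h1 (sub_nonneg.2 hE1), mul_le_mul_of_nonneg_left hE a.2]

/-! ### Approximation by log-Hölder functions -/

section Approximation

variable {Λ : Type*} [MetricSpace Λ] [BoundedSpace Λ] {η : ℝ≥0}

lemma exists_dist_rpow_le (Λ : Type*) [MetricSpace Λ] [BoundedSpace Λ] (η : ℝ≥0) :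
    ∃ D : ℝ, 0 ≤ D ∧ ∀ x y : Λ, dist x y ^ (η : ℝ) ≤ D :=
  ⟨Metric.diam (univ : Set Λ) ^ (η : ℝ), by positivity, fun x y => by
    gcongr
    exact Metric.dist_le_diam_of_mem (Bornology.IsBounded.all _) (mem_univ x) (mem_univ y)⟩

lemma exists_dist_le_mul_rpow (Λ : Type*) [MetricSpace Λ] [BoundedSpace Λ] (hη : η ≤ 1) :
    ∃ D : ℝ, 0 ≤ D ∧ ∀ x y : Λ, dist x y ≤ D * dist x y ^ (η : ℝ) := by
  refine ⟨Metric.diam (univ : Set Λ) ^ (1 - η : ℝ), by positivity, fun x y => ?_⟩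
  have hη' : 0 ≤ 1 - (η : ℝ) := sub_nonneg.2 (by exact_mod_cast hη)
  calc dist x y = dist x y ^ (1 - η : ℝ) * dist x y ^ (η : ℝ) := by
        rw [← Real.rpow_add_of_nonneg (dist_nonneg (x := x) (y := y)) hη' η.coe_nonneg]; simp
    _ ≤ _ := by
        gcongr
        exact Metric.dist_le_diam_of_mem (Bornology.IsBounded.all _) (mem_univ x) (mem_univ y)

/-- The logarithm of a `K`-Lipschitz function bounded below by `c` is `K / c`-Lipschitz, and on a
bounded space `d ≤ D d^η`. -/
lemma logHolder_of_lipschitz (hη : η ≤ 1) {f : Λ → ℝ≥0} {K c : ℝ≥0} (hc : 0 < c)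
    (hf : LipschitzWith K f) (hcf : ∀ x, c ≤ f x) :
    ∃ R : ℝ, LogHolder univ η R (fun x => (f x : ℝ≥0∞)) := by
  obtain ⟨D, hD, hD'⟩ := exists_dist_le_mul_rpow Λ hη
  refine ⟨K * D / c, fun x _ y _ => ?_⟩
  rw [ENNReal.ofReal, ← ENNReal.coe_mul, ENNReal.coe_le_coe, ← NNReal.coe_le_coe, NNReal.coe_mul,
    Real.coe_toNNReal _ (Real.exp_pos _).le]
  have h1 : (f x : ℝ) ≤ f y + K * (D * dist x y ^ (η : ℝ)) := by
    have := (hf.dist_le_mul x y).trans (mul_le_mul_of_nonneg_left (hD' x y) K.2)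
    rw [NNReal.dist_eq] at this
    linarith [le_abs_self ((f x : ℝ) - f y)]
  have hc' : (0 : ℝ) < c := hc
  have h2 : (c : ℝ) ≤ f y := hcf y
  set t := dist x y ^ (η : ℝ)
  have ht : 0 ≤ K * D / c * t := by positivity
  calc (f x : ℝ) ≤ f y + K * (D * t) := h1
    _ = f y + K * D / c * t * c := by field_simp
    _ ≤ f y + K * D / c * t * f y := by gcongr
    _ = (K * D / c * t + 1) * f y := by ring
    _ ≤ _ := by gcongr; exact Real.add_one_le_exp _

variable [MeasurableSpace Λ] [BorelSpace Λ] {m : Measure Λ} [IsFiniteMeasure m]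

/-- `f` can be approximated in `L¹(m)` by log-Hölder functions. -/
def ApproxLogHolder (m : Measure Λ) (η : ℝ≥0) (f : Λ → ℝ≥0∞) : Prop :=
  ∀ δ : ℝ≥0∞, 0 < δ → ∃ (R : ℝ) (g e : Λ → ℝ≥0∞), Measurable g ∧ Measurable e ∧
    LogHolder univ η R g ∧ (∀ x, f x ≤ g x + e x) ∧ (∀ x, g x ≤ f x + e x) ∧ ∫⁻ x, e x ∂m ≤ δ

omit [BoundedSpace Λ] [BorelSpace Λ] [IsFiniteMeasure m] in
lemma ApproxLogHolder.add {f g : Λ → ℝ≥0∞} (hf : ApproxLogHolder m η f)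
    (hg : ApproxLogHolder m η g) : ApproxLogHolder m η (fun x => f x + g x) := by
  intro δ hδ
  obtain ⟨R, f', e, hf'm, hem, hf', h1, h2, h3⟩ := hf (δ / 2) (ENNReal.half_pos hδ.ne')
  obtain ⟨R', g', e', hg'm, hem', hg', h1', h2', h3'⟩ := hg (δ / 2) (ENNReal.half_pos hδ.ne')
  refine ⟨max R R', fun x => f' x + g' x, fun x => e x + e' x, hf'm.add hg'm, hem.add hem',
    (hf'.mono (le_max_left _ _)).add (hg'.mono (le_max_right _ _)), fun x => ?_, fun x => ?_, ?_⟩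
  · rw [add_add_add_comm]; exact add_le_add (h1 x) (h1' x)
  · rw [add_add_add_comm]; exact add_le_add (h2 x) (h2' x)
  · rw [lintegral_add_left hem]
    exact (add_le_add h3 h3').trans (ENNReal.add_halves δ).le

omit [BoundedSpace Λ] [BorelSpace Λ] [IsFiniteMeasure m] in
lemma ApproxLogHolder.const_mul {f : Λ → ℝ≥0∞} (hf : ApproxLogHolder m η f) {c : ℝ≥0∞}
    (hc : c ≠ ∞) : ApproxLogHolder m η (fun x => c * f x) := by
  intro δ hδ
  rcases eq_or_ne c 0 with rfl | hc0
  · exact ⟨0, 0, 0, measurable_zero, measurable_zero, fun x _ y _ => by simp, by simp, by simp,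
      by simp⟩
  obtain ⟨R, f', e, hf'm, hem, hf', h1, h2, h3⟩ := hf (δ / c) (ENNReal.div_pos hδ.ne' hc)
  refine ⟨R, fun x => c * f' x, fun x => c * e x, hf'm.const_mul c, hem.const_mul c,
    hf'.const_mul c, fun x => ?_, fun x => ?_, ?_⟩
  · rw [← mul_add]; exact mul_le_mul_right (h1 x) c
  · rw [← mul_add]; exact mul_le_mul_right (h2 x) c
  · rw [lintegral_const_mul c hem]
    exact (mul_le_mul_right h3 c).trans (ENNReal.mul_div_le)

omit [BoundedSpace Λ] [BorelSpace Λ] [IsFiniteMeasure m] in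
lemma ApproxLogHolder.of_approx {f : Λ → ℝ≥0∞}
    (H : ∀ δ : ℝ≥0∞, 0 < δ → ∃ g e : Λ → ℝ≥0∞, ApproxLogHolder m η g ∧ Measurable e ∧
      (∀ x, f x ≤ g x + e x) ∧ (∀ x, g x ≤ f x + e x) ∧ ∫⁻ x, e x ∂m ≤ δ) :
    ApproxLogHolder m η f := by
  intro δ hδ
  obtain ⟨g, e, hg, he, h1, h2, h3⟩ := H (δ / 2) (ENNReal.half_pos hδ.ne')
  obtain ⟨R, g', e', hg'm, hem', hg', h1', h2', h3'⟩ := hg (δ / 2) (ENNReal.half_pos hδ.ne')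
  refine ⟨R, g', fun x => e x + e' x, hg'm, he.add hem', hg', fun x => ?_, fun x => ?_, ?_⟩
  · calc f x ≤ g x + e x := h1 x
      _ ≤ g' x + e' x + e x := by gcongr; exact h1' x
      _ = _ := by ring
  · calc g' x ≤ g x + e' x := h2' x
      _ ≤ f x + e x + e' x := by gcongr; exact h2 x
      _ = _ := by ring
  · rw [lintegral_add_left he]
    exact (add_le_add h3 h3').trans (ENNReal.add_halves δ).le

/-- Inner regularity reduces to closed sets, whose indicators are limits of Lipschitz thickened
indicators. -/
lemma approxLogHolder_indicator (hη : η ≤ 1) {s : Set Λ} (hs : MeasurableSet s) :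
    ApproxLogHolder m η (s.indicator 1) := by
  refine .of_approx fun δ hδ => ?_
  obtain ⟨F, hFs, hF, hsF⟩ := hs.exists_isClosed_sdiff_lt (measure_ne_top m s) hδ.ne'
  refine ⟨F.indicator 1, (s \ F).indicator 1, ?_,
    measurable_one.indicator (hs.diff hF.measurableSet), fun x => ?_, fun x => ?_, ?_⟩
  · intro ε hε
    -- Adding `c` keeps the approximant away from zero, as log-Hölder regularity requires, at an
    -- `L¹` cost of at most `ε / 2`.
    obtain ⟨c, hc0, hc⟩ : ∃ c : ℝ≥0, 0 < c ∧ (c : ℝ≥0∞) * m univ ≤ ε / 2 := by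
      have hε2 : ε / 2 ≠ 0 := (ENNReal.half_pos hε.ne').ne'
      obtain ⟨c, hc0, hc⟩ := ENNReal.exists_nnreal_pos_mul_lt (measure_ne_top m univ) hε2
      exact ⟨c, hc0, hc.le⟩
    have hlim := tendsto_lintegral_thickenedIndicator_of_isClosed m hF
      (δs := fun n : ℕ => 1 / ((n : ℝ) + 1)) (fun n => Nat.one_div_pos_of_nat)
      tendsto_one_div_add_atTop_nhds_zero_nat
    obtain ⟨n, hn⟩ := (hlim.eventually_le_const
      (ENNReal.lt_add_right (measure_ne_top m F) (ENNReal.half_pos hε.ne').ne')).exists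
    have hpos : (0 : ℝ) < 1 / ((n : ℝ) + 1) := Nat.one_div_pos_of_nat
    set u := thickenedIndicator hpos F
    have hum : Measurable fun x => (u x : ℝ≥0∞) :=
      (u.continuous.measurable).coe_nnreal_ennreal
    have hind : ∀ x, F.indicator 1 x ≤ (u x : ℝ≥0∞) := fun x => by
      by_cases hx : x ∈ F
      · rw [show u x = 1 from thickenedIndicator_one hpos F hx]; simp [hx]
      · simp [hx]
    obtain ⟨R, hR⟩ := logHolder_of_lipschitz hη (f := fun x => u x + c) (c := c) hc0
      (K := _) (.of_dist_le_mul fun x y => by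
        have := (lipschitzWith_thickenedIndicator hpos F).dist_le_mul x y
        rw [NNReal.dist_eq] at this ⊢
        rw [NNReal.coe_add, NNReal.coe_add, add_sub_add_right_eq_sub]
        exact this)
      (fun x => le_add_self)
    have hm1 : Measurable (F.indicator (1 : Λ → ℝ≥0∞)) := measurable_one.indicator hF.measurableSet
    refine ⟨R, _, fun x => ((u x : ℝ≥0∞) - F.indicator 1 x) + c, ?_,
      (hum.sub hm1).add_const _, hR, fun x => ?_, fun x => ?_, ?_⟩
    · simpa using hum.add_const _
    · push_cast
      exact (hind x).trans (le_add_right (le_add_right le_rfl))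
    · push_cast
      rw [← add_assoc, add_tsub_cancel_of_le (hind x)]
    · have hfin : ∫⁻ x, F.indicator 1 x ∂m ≠ ∞ := by
        rw [lintegral_indicator_one hF.measurableSet]; exact measure_ne_top m F
      rw [lintegral_add_right _ measurable_const, lintegral_sub hm1 hfin (.of_forall hind),
        lintegral_indicator_one hF.measurableSet, lintegral_const]
      refine (add_le_add (tsub_le_iff_left.2 hn) hc).trans (ENNReal.add_halves ε).le
  · by_cases h1 : x ∈ s <;> by_cases h2 : x ∈ F <;> simp [h1, h2]
  · by_cases h2 : x ∈ F
    · simp [h2, hFs h2]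
    · simp [h2]
  · rw [lintegral_indicator_one (hs.diff hF.measurableSet)]
    exact hsF.le

lemma approxLogHolder_of_lintegral_ne_top (hη : η ≤ 1) {f : Λ → ℝ≥0∞} (hf : Measurable f)
    (hfi : ∫⁻ x, f x ∂m ≠ ∞) : ApproxLogHolder m η f := by
  revert hfi
  refine Measurable.ennreal_induction (motive := fun f => ∫⁻ x, f x ∂m ≠ ∞ → ApproxLogHolder m η f)
    ?_ ?_ ?_ hf
  · intro c s hs hfi
    rcases eq_or_ne c ∞ with rfl | hc
    · rw [lintegral_indicator_const hs] at hfi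
      have hms : m s = 0 := by
        by_contra h
        exact hfi (ENNReal.top_mul h)
      refine .of_approx fun δ hδ => ⟨0, s.indicator fun _ => ∞, ?_,
        measurable_const.indicator hs, by simp, by simp, by simp [hs, hms]⟩
      exact fun δ _ => ⟨0, 0, 0, measurable_zero, measurable_zero, fun x _ y _ => by simp, by simp,
        by simp, by simp⟩
    · have := (approxLogHolder_indicator (m := m) hη hs).const_mul hc
      convert this using 2 with x
      by_cases hx : x ∈ s <;> simp [hx]
  · intro f g _ hf hg h1 h2 hfg
    have hfg' : ∫⁻ x, f x ∂m + ∫⁻ x, g x ∂m ≠ ∞ := by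
      rw [← lintegral_add_left hf]; exact hfg
    exact (h1 (ENNReal.add_ne_top.1 hfg').1).add (h2 (ENNReal.add_ne_top.1 hfg').2)
  · intro f hfm hmono hap hfi
    refine .of_approx fun δ hδ => ?_
    have hsup := lintegral_iSup (μ := m) hfm hmono
    have hle : ∀ n x, f n x ≤ ⨆ n, f n x := fun n x => le_iSup (fun n => f n x) n
    have hn : ∀ n, ∫⁻ x, f n x ∂m ≠ ∞ := fun n => ne_top_of_le_ne_top hfi (lintegral_mono (hle n))
    have hlt : ∀ᶠ n in atTop, ∫⁻ x, (⨆ n, f n x) ∂m ≤ ∫⁻ x, f n x ∂m + δ := by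
      have ht := (tendsto_atTop_iSup (fun i j hij => lintegral_mono (hmono hij))
        : Tendsto (fun n => ∫⁻ x, f n x ∂m) atTop _).add_const δ
      rw [← hsup] at ht
      exact ht.eventually_const_le (ENNReal.lt_add_right hfi hδ.ne')
    obtain ⟨n, hn'⟩ := hlt.exists
    refine ⟨f n, fun x => (⨆ n, f n x) - f n x, hap n (hn n),
      (Measurable.iSup hfm).sub (hfm n), fun x => ?_, fun x => ?_, ?_⟩
    · exact le_add_tsub
    · exact (hle n x).trans le_self_add
    · rw [lintegral_sub (hfm n) (hn n) (.of_forall (hle n))]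
      exact tsub_le_iff_left.2 hn'

end Approximation

/-! ### Maps with countably many full branches -/

/-- The transfer operator `f ↦ ∑ₐ w a · f ∘ s a`. -/
def transferOp {Λ ι : Type*} (s : ι → Λ → Λ) (w : ι → Λ → ℝ≥0∞) (f : Λ → ℝ≥0∞) (y : Λ) : ℝ≥0∞ :=
  ∑' a, f (s a y) * w a y

/-- `F` has inverse branches `s a` with weights `w a` on the full measure set `G`, which contract
`d ^ η` by the factor `θ` and have log-Hölder weights with constant `C`. -/
structure FullBranches {Λ ι : Type*} [MetricSpace Λ] [MeasurableSpace Λ] (m : Measure Λ)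
    (F : Λ → Λ) (G : Set Λ) (s : ι → Λ → Λ) (w : ι → Λ → ℝ≥0∞) (η : ℝ≥0) (θ C : ℝ) : Prop where
  measurable_F : Measurable F
  measurable_s : ∀ a, Measurable (s a)
  measurable_w : ∀ a, Measurable (w a)
  mapsTo : ∀ a, ∀ y ∈ G, s a y ∈ G
  ae_mem : ∀ᵐ y ∂m, y ∈ G
  contraction : ∀ a, ∀ x ∈ G, ∀ y ∈ G,
    dist (s a x) (s a y) ^ (η : ℝ) ≤ θ * dist x y ^ (η : ℝ)
  logHolder_w : ∀ a, LogHolder G η C (w a)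
  transfer : ∀ f u : Λ → ℝ≥0∞, Measurable f → Measurable u →
    ∫⁻ x, f x * u (F x) ∂m = ∫⁻ y, transferOp s w f y * u y ∂m

section TransferOp

variable {Λ ι : Type*} {s : ι → Λ → Λ} {w : ι → Λ → ℝ≥0∞} {f g e : Λ → ℝ≥0∞}

lemma transferOp_le_add (h : ∀ x, f x ≤ g x + e x) (y : Λ) :
    transferOp s w f y ≤ transferOp s w g y + transferOp s w e y := by
  rw [transferOp, transferOp, transferOp, ← ENNReal.tsum_add]
  refine ENNReal.tsum_le_tsum fun a => ?_
  rw [← add_mul]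
  exact mul_le_mul_left (h _) _

lemma iterate_transferOp_le_add (h : ∀ x, f x ≤ g x + e x) (k : ℕ) (y : Λ) :
    (transferOp s w)^[k] f y ≤ (transferOp s w)^[k] g y + (transferOp s w)^[k] e y := by
  induction k generalizing y with
  | zero => exact h y
  | succ k ih =>
    simp only [Function.iterate_succ_apply']
    exact transferOp_le_add ih y

end TransferOp

/-! ### Cone contraction for the transfer operator. -/

namespace FullBranches

variable {Λ ι : Type*} [MetricSpace Λ] [MeasurableSpace Λ] {m : Measure Λ} {F : Λ → Λ}
  {G : Set Λ} {s : ι → Λ → Λ} {w : ι → Λ → ℝ≥0∞} {η : ℝ≥0} {θ C R K D : ℝ} {f g h : Λ → ℝ≥0∞}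

/-- Regularity is required only of `f` along each inverse branch, not of `f` globally. This admits
functions such as `τ`, which are regular on partition elements but unbounded. -/
lemma logHolder_transferOp (H : FullBranches m F G s w η θ C)
    (hf : ∀ a, LogHolder G η K fun y => f (s a y)) : LogHolder G η (K + C) (transferOp s w f) := by
  intro x hx y hy
  rw [transferOp, transferOp, ← ENNReal.tsum_mul_left]
  exact ENNReal.tsum_le_tsum fun a => ((hf a).mul (H.logHolder_w a)) x hx y hy

lemma logHolder_comp (H : FullBranches m F G s w η θ C) (hK : 0 ≤ K) (hf : LogHolder G η K f)
    (a : ι) : LogHolder G η (K * θ) fun y => f (s a y) := by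
  intro x hx y hy
  refine (hf _ (H.mapsTo a x hx) _ (H.mapsTo a y hy)).trans ?_
  rw [mul_assoc]
  gcongr
  exact H.contraction a x hx y hy

/-- Each step replaces the constant `K` by `K θ + C`, so any initial constant is eventually
forgotten up to `C / (1 - θ)`. -/
lemma logHolder_iterate (H : FullBranches m F G s w η θ C) (hθ : 0 ≤ θ) (hθ' : θ < 1) (hC : 0 ≤ C)
    (hK : 0 ≤ K) (hf : LogHolder G η K f) (k : ℕ) :
    LogHolder G η (K * θ ^ k + C / (1 - θ)) ((transferOp s w)^[k] f) := by
  have h1 : 0 < 1 - θ := sub_pos.2 hθ'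
  induction k with
  | zero => exact hf.mono (by simp; positivity)
  | succ k ih =>
    rw [Function.iterate_succ_apply']
    convert H.logHolder_transferOp fun a => H.logHolder_comp (by positivity) ih a using 1
    field_simp
    ring

variable [Countable ι]

lemma measurable_transferOp (H : FullBranches m F G s w η θ C) (hf : Measurable f) :
    Measurable (transferOp s w f) :=
  Measurable.tsum fun a => (hf.comp (H.measurable_s a)).mul (H.measurable_w a)

lemma measurable_iterate (H : FullBranches m F G s w η θ C) (hf : Measurable f) (k : ℕ) :
    Measurable ((transferOp s w)^[k] f) := by
  induction k with
  | zero => exact hf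
  | succ k ih =>
    rw [Function.iterate_succ_apply']
    exact H.measurable_transferOp ih

lemma transfer_iterate (H : FullBranches m F G s w η θ C) {u : Λ → ℝ≥0∞} (hf : Measurable f)
    (hu : Measurable u) (k : ℕ) :
    ∫⁻ x, f x * u (F^[k] x) ∂m = ∫⁻ y, (transferOp s w)^[k] f y * u y ∂m := by
  induction k generalizing f with
  | zero => rfl
  | succ k ih =>
    simp only [Function.iterate_succ_apply]
    rw [← ih (H.measurable_transferOp hf)]
    exact H.transfer f (fun x => u (F^[k] x)) hf (hu.comp (H.measurable_F.iterate k))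

omit [Countable ι] in
lemma lintegral_transferOp (H : FullBranches m F G s w η θ C) (hf : Measurable f) :
    ∫⁻ y, transferOp s w f y ∂m = ∫⁻ x, f x ∂m := by
  simpa using (H.transfer f 1 hf measurable_one).symm

lemma lintegral_iterate (H : FullBranches m F G s w η θ C) (hf : Measurable f) (k : ℕ) :
    ∫⁻ y, (transferOp s w)^[k] f y ∂m = ∫⁻ x, f x ∂m := by
  simpa using (H.transfer_iterate hf measurable_one k).symm

/-- A Doeblin type splitting of `P f` into a constant and a remainder in the same cone. -/
lemma exists_split (H : FullBranches m F G s w η θ C) [IsFiniteMeasure m] (hm : m univ ≠ 0)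
    (hD : ∀ x y : Λ, dist x y ^ (η : ℝ) ≤ D) (hθ : 0 ≤ θ) (hC : 0 < C) (hR : 0 ≤ R)
    (hRC : R * θ + C < R) {δ : ℝ}
    (hδ : δ = (1 - (R * θ + C) / R) * Real.exp (-((R * θ + C) * D)))
    (hf : Measurable f) (hfR : LogHolder G η R f) (hfi : ∫⁻ x, f x ∂m ≠ ∞) :
    ∃ r : Λ → ℝ≥0∞, Measurable r ∧ LogHolder G η R r ∧ ∫⁻ x, r x ∂m = ∫⁻ x, f x ∂m ∧
      ∀ y ∈ G, transferOp s w f y =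
        ENNReal.ofReal δ * (∫⁻ x, f x ∂m) / m univ + ENNReal.ofReal (1 - δ) * r y := by
  set R' := R * θ + C
  set I := ∫⁻ x, f x ∂m
  have hR' : 0 ≤ R' := by positivity
  have hR0 : 0 < R := hR'.trans_lt hRC
  have hm' := measure_ne_top m univ
  have hlt : R' / R < 1 := (div_lt_one hR0).2 hRC
  have hδ0 : 0 ≤ δ := by
    rw [hδ]
    exact mul_nonneg (sub_nonneg.2 hlt.le) (Real.exp_pos _).le
  by_cases hG : G.Nonempty
  swap
  · have : ∀ᵐ y ∂m, False := H.ae_mem.mono fun y hy => hG ⟨y, hy⟩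
    simp only [eventually_false_iff_eq_bot, ae_eq_bot] at this
    exact absurd (by simp [this]) hm
  have hD0 : 0 ≤ D := by
    obtain ⟨y, -⟩ := hG
    exact le_trans (by positivity) (hD y y)
  set P := transferOp s w f
  have hP : Measurable P := H.measurable_transferOp hf
  have hPL : LogHolder G η R' P := H.logHolder_transferOp (H.logHolder_comp hR hfR)
  have hPI : ∫⁻ x, P x ∂m = I := H.lintegral_transferOp hf
  -- `P` lies in the cone of `R'`, so it is at least `exp (-R' D)` times its mean. The factor `1 -
  -- R' / R` in `δ` is the part of this lower bound that `LogHolder.tsub_const` can remove while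
  -- staying in the cone of `R`.
  set c := ENNReal.ofReal δ * I / m univ
  have hc : c ≠ ∞ := ENNReal.div_ne_top (ENNReal.mul_ne_top ENNReal.ofReal_ne_top hfi) hm
  have hcm : c * m univ = ENNReal.ofReal δ * I := ENNReal.div_mul_cancel hm hm'
  have hexp : ENNReal.ofReal (Real.exp (-(R' * D))) * ENNReal.ofReal (Real.exp (R' * D)) = 1 := by
    rw [← ENNReal.ofReal_mul (Real.exp_pos _).le, ← Real.exp_add]
    simp
  have hcP : ∀ x ∈ G, c ≤ ENNReal.ofReal (1 - R' / R) * P x := by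
    intro x hx
    have h1 := hPL.lintegral_le hR' hD H.ae_mem hx
    rw [hPI] at h1
    rw [← ENNReal.mul_le_mul_iff_left hm hm', hcm, hδ,
      ENNReal.ofReal_mul (sub_nonneg.2 hlt.le), mul_assoc, mul_assoc]
    refine mul_le_mul_right ?_ _
    rw [← one_mul (P x * m univ), ← hexp, mul_assoc, ← mul_assoc (ENNReal.ofReal (Real.exp _)) (P x)]
    exact mul_le_mul_right h1 _
  -- Strictness comes from `C > 0`, and allows the remainder to be divided by `1 - δ`, which
  -- restores the integral of `f`.
  have hδ1 : δ < 1 := by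
    rw [hδ]
    have hR'1 : 0 < R' / R := by positivity
    calc _ ≤ (1 - R' / R) * 1 := by
          gcongr
          exact Real.exp_le_one_iff.2 (by simpa using mul_nonneg hR' hD0)
      _ < 1 := by linarith
  have hc1 : ENNReal.ofReal (1 - δ) ≠ 0 := by simpa using hδ1
  have hsum : ENNReal.ofReal δ * I + ENNReal.ofReal (1 - δ) * I = I := by
    rw [← add_mul, ← ENNReal.ofReal_add hδ0 (sub_nonneg.2 hδ1.le)]
    simp
  have hcP' : ∀ x ∈ G, c ≤ P x := fun x hx => (hcP x hx).trans <|
    mul_le_of_le_one_left zero_le <| ENNReal.ofReal_le_one.2 <|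
      sub_le_self _ (div_nonneg hR' hR)
  refine ⟨fun y => (ENNReal.ofReal (1 - δ))⁻¹ * (P y - c), (hP.sub_const c).const_mul _,
    (hPL.tsub_const hR' hRC hc hcP).const_mul _, ?_, fun y hy => ?_⟩
  · rw [lintegral_const_mul _ (hP.sub_const c), lintegral_sub measurable_const (by
      rw [lintegral_const]; exact ENNReal.mul_ne_top hc hm') (H.ae_mem.mono hcP'), hPI,
      lintegral_const, hcm]
    rw [ENNReal.sub_eq_of_eq_add (ENNReal.mul_ne_top ENNReal.ofReal_ne_top hfi)
      (hsum.symm.trans (add_comm _ _)), ← mul_assoc, ENNReal.inv_mul_cancel hc1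
      ENNReal.ofReal_ne_top, one_mul]
  · rw [← mul_assoc, ENNReal.mul_inv_cancel hc1 ENNReal.ofReal_ne_top, one_mul,
      add_tsub_cancel_of_le (hcP' y hy)]

/-- A coupling argument: at each step `f` and `g` shed the same constant, since their integrals
agree, and the remainders stay in the cone with weight `1 - δ`. What is left after `k` steps is
bounded crudely against `h`. The bound is one-sided, and exchanging `f` and `g` gives the other
side. -/
lemma decay (H : FullBranches m F G s w η θ C) [IsFiniteMeasure m] (hm : m univ ≠ 0)
    (hD : ∀ x y : Λ, dist x y ^ (η : ℝ) ≤ D) (hθ : 0 ≤ θ) (hC : 0 < C) (hR : 0 ≤ R)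
    (hRC : R * θ + C < R) {δ : ℝ}
    (hδ : δ = (1 - (R * θ + C) / R) * Real.exp (-((R * θ + C) * D)))
    (hh : LogHolder G η R h) (hhi : ∫⁻ x, h x ∂m = 1)
    {u : Λ → ℝ≥0∞} (hu : Measurable u) {I : ℝ≥0∞} (hI : I ≠ ∞) (k : ℕ) :
    ∀ f g : Λ → ℝ≥0∞, Measurable f → Measurable g → LogHolder G η R f → LogHolder G η R g →
      ∫⁻ x, f x ∂m = I → ∫⁻ x, g x ∂m = I →
      ∫⁻ x, f x * u (F^[k] x) ∂m ≤ ∫⁻ x, g x * u (F^[k] x) ∂m +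
        ENNReal.ofReal (1 - δ) ^ k *
          (ENNReal.ofReal (Real.exp (R * D)) ^ 2 * I * ∫⁻ x, h x * u x ∂m) := by
  induction k with
  | zero =>
    intro f g hf _ hfR _ hfI _
    refine le_add_left ?_
    rw [pow_zero, one_mul, ← lintegral_const_mul' _ _
      (ENNReal.mul_ne_top (ENNReal.pow_ne_top ENNReal.ofReal_ne_top) hI)]
    refine lintegral_mono_ae ?_
    filter_upwards [H.ae_mem] with x hx
    rw [← mul_assoc]
    refine mul_le_mul_left ?_ _
    -- Cone functions are comparable to their means: `f` is at most `E` times its mean, and the mean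
    -- of `h` is at most `E h`. Together these give `f ≤ E² I h`.
    have h1 := hfR.mul_measure_le hR hD H.ae_mem hx
    have h2 := hh.lintegral_le hR hD H.ae_mem hx
    rw [hfI] at h1
    rw [hhi] at h2
    set E := ENNReal.ofReal (Real.exp (R * D))
    calc f x = f x * 1 := (mul_one _).symm
      _ ≤ f x * (E * h x * m univ) := by gcongr
      _ = E * h x * (f x * m univ) := by ring
      _ ≤ E * h x * (E * I) := by gcongr
      _ = _ := by ring
  | succ k ih =>
    intro f g hf hg hfR hgR hfI hgI
    obtain ⟨r, hr, hrR, hrI, hrP⟩ := H.exists_split hm hD hθ hC hR hRC hδ hf hfR (hfI ▸ hI)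
    obtain ⟨q, hq, hqR, hqI, hqP⟩ := H.exists_split hm hD hθ hC hR hRC hδ hg hgR (hgI ▸ hI)
    rw [hfI] at hrI hrP
    rw [hgI] at hqI hqP
    set c := ENNReal.ofReal δ * I / m univ
    set c1 := ENNReal.ofReal (1 - δ)
    have huk : Measurable fun x => u (F^[k] x) := hu.comp (H.measurable_F.iterate k)
    have key : ∀ φ ψ : Λ → ℝ≥0∞, Measurable φ → Measurable ψ →
        (∀ y ∈ G, transferOp s w φ y = c + c1 * ψ y) →
        ∫⁻ x, φ x * u (F^[k + 1] x) ∂m =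
          c * ∫⁻ x, u (F^[k] x) ∂m + c1 * ∫⁻ x, ψ x * u (F^[k] x) ∂m := by
      intro φ ψ hφ hψ hP
      have hψu : Measurable fun x => ψ x * u (F^[k] x) := hψ.mul huk
      simp only [Function.iterate_succ_apply]
      rw [H.transfer φ (fun x => u (F^[k] x)) hφ huk, ← lintegral_const_mul _ huk,
        ← lintegral_const_mul _ hψu, ← lintegral_add_left (huk.const_mul c)]
      refine lintegral_congr_ae ?_
      filter_upwards [H.ae_mem] with x hx
      rw [hP x hx, add_mul, mul_assoc]
    rw [key f r hf hr hrP, key g q hg hq hqP, pow_succ', mul_assoc, add_assoc, ← mul_add]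
    gcongr
    exact ih r q hr hq hrR hqR hrI hqI

/-- An invariant density has a log-Hölder version. -/
lemma exists_logHolder_density [BoundedSpace Λ] [BorelSpace Λ] [IsFiniteMeasure m]
    (H : FullBranches m F G s w η θ C) (hθ : 0 ≤ θ) (hθ' : θ < 1) (hC : 0 < C) (hη : η ≤ 1)
    (hR : C / (1 - θ) < R)
    (hh : Measurable h) (hhi : ∫⁻ x, h x ∂m ≠ ∞)
    (hinv : ∀ u : Λ → ℝ≥0∞, Measurable u → ∫⁻ x, h x * u (F x) ∂m = ∫⁻ x, h x * u x ∂m) :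
    ∃ h' : Λ → ℝ≥0∞, Measurable h' ∧ LogHolder G η R h' ∧ h' =ᵐ[m] h := by
  set P := transferOp s w
  -- By duality, weak invariance of the density says that it is a fixed point of `P`.
  have hinvk : ∀ k, P^[k] h =ᵐ[m] h := by
    intro k
    refine ae_eq_of_forall_setLIntegral_eq_of_sigmaFinite (H.measurable_iterate hh k) hh
      fun t ht _ => ?_
    have hk : ∀ u : Λ → ℝ≥0∞, Measurable u →
        ∫⁻ x, h x * u (F^[k] x) ∂m = ∫⁻ x, h x * u x ∂m := by
      intro u hu
      induction k with
      | zero => rfl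
      | succ k ih =>
        simp only [Function.iterate_succ_apply]
        rw [hinv (fun x => u (F^[k] x)) (hu.comp (H.measurable_F.iterate k)), ih]
    have h1 := hk (t.indicator 1) (measurable_one.indicator ht)
    rw [H.transfer_iterate hh (measurable_one.indicator ht)] at h1
    rw [← lintegral_indicator ht, ← lintegral_indicator ht]
    convert h1 using 2 <;>
    · ext x
      by_cases hx : x ∈ t <;> simp [hx]; try rfl
  -- Approximate `h` in `L¹` by a log-Hölder `g` and apply `P^k`. This fixes `h`, preserves the
  -- integral of the dominating error by positivity, and brings the uncontrolled constant of `g`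
  -- below `R`.
  have hstep : ∀ i : ℕ, ∃ ψ e : Λ → ℝ≥0∞, Measurable ψ ∧ Measurable e ∧ LogHolder G η R ψ ∧
      (∀ᵐ x ∂m, h x ≤ ψ x + e x) ∧ (∀ᵐ x ∂m, ψ x ≤ h x + e x) ∧
      ∫⁻ x, e x ∂m ≤ (1 / 2) ^ i := by
    intro i
    obtain ⟨K, g, e, hg, he, hgK, h1, h2, h3⟩ :=
      approxLogHolder_of_lintegral_ne_top hη hh hhi ((1 / 2) ^ i) (ENNReal.pow_pos (by simp) i)
    have hlim : Tendsto (fun k : ℕ => max K 0 * θ ^ k + C / (1 - θ)) atTop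
        (𝓝 (max K 0 * 0 + C / (1 - θ))) :=
      ((tendsto_pow_atTop_nhds_zero_of_lt_one hθ hθ').const_mul _).add_const _
    obtain ⟨k, hk⟩ := (hlim.eventually_lt_const (by simpa using hR)).exists
    refine ⟨P^[k] g, P^[k] e, H.measurable_iterate hg k, H.measurable_iterate he k,
      (H.logHolder_iterate hθ hθ' hC.le (le_max_right K 0)
        ((hgK.mono_set (subset_univ G)).mono (le_max_left K 0)) k).mono hk.le, ?_, ?_, ?_⟩
    · filter_upwards [hinvk k] with x hx
      rw [← hx]
      exact iterate_transferOp_le_add h1 k x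
    · filter_upwards [hinvk k] with x hx
      rw [← hx]
      exact iterate_transferOp_le_add h2 k x
    · rw [H.lintegral_iterate he]
      exact h3
  choose ψ e hψ he hψR h1 h2 h3 using hstep
  -- The errors have summable integrals, so `ψ n → h` almost everywhere. The `limsup` is a version
  -- of `h` that is log-Hölder at every point of `G`.
  refine ⟨fun x => limsup (fun n => ψ n x) atTop, Measurable.limsup hψ, .limsup hψR, ?_⟩
  have hsum : ∫⁻ x, ∑' i, e i x ∂m ≠ ∞ := by
    rw [lintegral_tsum fun i => (he i).aemeasurable]
    refine ne_top_of_le_ne_top ?_ (ENNReal.tsum_le_tsum h3)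
    rw [ENNReal.tsum_geometric]
    simp
  filter_upwards [ae_all_iff.2 h1, ae_all_iff.2 h2, ae_lt_top (.tsum fun i => he i) hsum,
    ae_lt_top hh hhi] with x hx1 hx2 hx3 hx4
  have hex : Tendsto (fun i => e i x) atTop (𝓝 0) := by
    rw [← Nat.cofinite_eq_atTop]
    exact ENNReal.tendsto_cofinite_zero_of_tsum_ne_top hx3.ne
  refine Tendsto.limsup_eq ?_
  refine tendsto_of_tendsto_of_tendsto_of_le_of_le (g := fun i => h x - e i x)
    (h := fun i => h x + e i x) ?_ ?_ (fun i => tsub_le_iff_right.2 (hx1 i)) (fun i => hx2 i)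
  · simpa using ENNReal.Tendsto.sub tendsto_const_nhds hex (.inl hx4.ne)
  · simpa using tendsto_const_nhds.add hex

end FullBranches

/-! ### The branches of the induced map -/

lemma measurable_iterate_prod {Λ : Type*} [MeasurableSpace Λ] {T : Λ → Λ} (hT : Measurable T) :
    Measurable fun z : Λ × ℕ => T^[z.2] z.1 :=
  measurable_from_prod_countable_left fun n => hT.iterate n

lemma InducingScheme.measurable_induced {Λ : Type*} [MeasurableSpace Λ] {I : InducingScheme Λ}
    {T : Λ → Λ} (hT : Measurable T) (hτ : Measurable I.τ) : Measurable (I.induced T) :=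
  (measurable_iterate_prod hT).comp (measurable_id.prodMk hτ)

namespace IsNonuniformlyExpanding

variable {Λ : Type*} [MetricSpace Λ] [MeasurableSpace Λ] {ρ : Measure Λ} {T : Λ → Λ}
  {I : InducingScheme Λ} {β C₁ : ℝ} {η : ℝ≥0}

lemma measurable_induced (h : IsNonuniformlyExpanding ρ T I β C₁ η) :
    Measurable (I.induced T) :=
  InducingScheme.measurable_induced h.nonsingular.measurable h.measurable_τ

lemma injOn (h : IsNonuniformlyExpanding ρ T I β C₁ η) {a : Set Λ} (ha : a ∈ I.α) :
    InjOn (I.induced T) a := fun x hx y hy hxy => by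
  have h1 := h.expansion a ha x hx y hy
  rw [hxy, dist_self] at h1
  exact dist_le_zero.1 (nonpos_of_mul_nonpos_right h1 (one_pos.trans h.one_lt_β))

/-- A set of full measure in `Y` on which all inverse branches are defined and which they
preserve. -/
lemma exists_good_set (h : IsNonuniformlyExpanding ρ T I β C₁ η) :
    ∃ G ⊆ I.Y, MeasurableSet G ∧ ρ (I.Y \ G) = 0 ∧
      ∀ a ∈ I.α, ∀ y ∈ G, ∃ x ∈ a, x ∈ G ∧ I.induced T x = y := by
  obtain ⟨ζ, hζ, hd⟩ := h.distortion
  choose! a' ha' b' hb' ham hbm ha0 hb0 hbij using h.bijection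
  have : Countable I.α := h.countable_α
  -- `N0` contains the points of `Y` possibly missed by some branch, and each later `N` covers the
  -- images of the previous one. Removing all of them makes the rest stable under inverse branches.
  -- Images of null sets are null by the Jacobian identity, and `toMeasurable` supplies measurable
  -- covers of them.
  let N0 : Set Λ := ⋃ a : I.α, I.Y \ b' a
  let N : ℕ → Set Λ := Nat.rec N0 fun _ S =>
    toMeasurable ρ (⋃ a : I.α, I.Y ∩ I.induced T '' (a ∩ S))
  have hNm : ∀ k, MeasurableSet (N k) := by
    rintro (_ | k)
    · exact .iUnion fun a => h.measurableSet_Y.diff (hbm a a.2)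
    · exact measurableSet_toMeasurable _ _
  have hN0 : ∀ k, ρ (N k) = 0 := by
    intro k
    induction k with
    | zero => exact measure_iUnion_null fun a => hb0 a a.2
    | succ k ih =>
      change ρ (toMeasurable ρ _) = 0
      rw [measure_toMeasurable]
      refine measure_iUnion_null fun a => ?_
      rw [(hd a a.2).2.1 _ inter_subset_left ((h.measurableSet_α a a.2).inter (hNm k))]
      exact setLIntegral_measure_zero _ _ (measure_mono_null inter_subset_right ih)
  refine ⟨I.Y \ ⋃ k, N k, sdiff_subset, h.measurableSet_Y.diff (.iUnion hNm), ?_, ?_⟩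
  · rw [sdiff_sdiff_right_self]
    exact measure_mono_null inter_subset_right (measure_iUnion_null hN0)
  · rintro a ha y ⟨hyY, hyN⟩
    have hyb : y ∈ b' a := by
      by_contra hy
      exact hyN (mem_iUnion.2 ⟨0, mem_iUnion.2 ⟨⟨a, ha⟩, hyY, hy⟩⟩)
    obtain ⟨x, hx, rfl⟩ := (hbij a ha).surjOn hyb
    have hxa := ha' a ha hx
    refine ⟨x, hxa, ⟨h.subset_Y a ha hxa, fun hxN => hyN ?_⟩, rfl⟩
    obtain ⟨k, hk⟩ := mem_iUnion.1 hxN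
    exact mem_iUnion.2 ⟨k + 1, subset_toMeasurable _ _
      (mem_iUnion.2 ⟨⟨a, ha⟩, hyY, mem_image_of_mem _ ⟨hxa, hk⟩⟩)⟩

/-- The Jacobian condition as a change of variables on one branch. The image of `F⁻¹ B ∩ a` fills `B
∩ Y` up to the null set missed by the branch. -/
lemma map_withDensity (h : IsNonuniformlyExpanding ρ T I β C₁ η) [IsFiniteMeasure ρ] {ζ : Λ → ℝ}
    {a : Set Λ} (ha : a ∈ I.α)
    (hζa : ∀ S ⊆ a, MeasurableSet S →
      ρ (I.Y ∩ I.induced T '' S) = ∫⁻ x in S, ENNReal.ofReal (ζ x)⁻¹ ∂ρ) :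
    ((ρ.restrict a).withDensity fun x => ENNReal.ofReal (ζ x)⁻¹).map (I.induced T) =
      ρ.restrict I.Y := by
  obtain ⟨a', ha', b', hb', ham, hbm, ha0, hb0, hbij⟩ := h.bijection a ha
  have ham := h.measurableSet_α a ha
  ext B hB
  have hpre := h.measurable_induced hB
  rw [Measure.map_apply h.measurable_induced hB, withDensity_apply _ hpre,
    Measure.restrict_restrict hpre, ← hζa _ inter_subset_right (hpre.inter ham),
    Measure.restrict_apply hB]
  refine le_antisymm (measure_mono ?_) ?_
  · rintro _ ⟨hy, x, hx, rfl⟩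
    exact ⟨hx.1, hy⟩
  · have hsub : B ∩ I.Y ⊆
        (I.Y ∩ I.induced T '' (I.induced T ⁻¹' B ∩ a)) ∪ (I.Y \ b') := by
      rintro y ⟨hyB, hyY⟩
      by_cases hyb : y ∈ b'
      · obtain ⟨x, hx, rfl⟩ := hbij.surjOn hyb
        exact .inl ⟨hyY, mem_image_of_mem _ ⟨hyB, ha' hx⟩⟩
      · exact .inr ⟨hyY, hyb⟩
    refine (measure_mono hsub).trans ((measure_union_le _ _).trans ?_)
    rw [hb0, add_zero]

lemma exists_fullBranches [BorelSpace Λ] [IsFiniteMeasure ρ]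
    (h : IsNonuniformlyExpanding ρ T I β C₁ η) :
    ∃ (G : Set Λ) (s : I.α → Λ → Λ) (w : I.α → Λ → ℝ≥0∞),
      FullBranches (ρ.restrict I.Y) (I.induced T) G s w η (β ^ (-(η : ℝ))) C₁ ∧
      ∀ a : I.α, ∀ y ∈ G, s a y ∈ (a : Set Λ) ∧ I.induced T (s a y) = y := by
  classical
  obtain ⟨G, hGY, hGm, hG0, hG⟩ := h.exists_good_set
  obtain ⟨ζ, hζ, hd⟩ := h.distortion
  have : Countable I.α := h.countable_α
  have hβ : 0 < β := one_pos.trans h.one_lt_β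
  choose! t hta htG htF using hG
  -- The chosen inverse branch is Lipschitz on `G`, by expansion. The identity off `G` makes it
  -- measurable everywhere.
  let s : I.α → Λ → Λ := fun a y => if y ∈ G then t a y else y
  have hst : ∀ a : I.α, ∀ y ∈ G, s a y = t a y := fun a y hy => if_pos hy
  have hdist : ∀ a : I.α, ∀ x ∈ G, ∀ y ∈ G, dist (s a x) (s a y) ≤ β⁻¹ * dist x y := by
    intro a x hx y hy
    rw [hst a x hx, hst a y hy, inv_mul_eq_div, le_div_iff₀' hβ]
    simpa only [htF a a.2 x hx, htF a a.2 y hy] using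
      h.expansion a a.2 _ (hta a a.2 x hx) _ (hta a a.2 y hy)
  have hsm : ∀ a, Measurable (s a) := by
    intro a
    refine measurable_of_restrict_of_restrict_compl hGm (Continuous.measurable ?_) ?_
    · exact (LipschitzWith.of_dist_le_mul (K := ⟨β⁻¹, (inv_pos.2 hβ).le⟩)
        fun (x y : G) => hdist a x x.2 y y.2).continuous
    · have : Gᶜ.domRestrict (s a) = Subtype.val := by
        ext x
        exact if_neg x.2
      rw [this]
      exact measurable_subtype_coe
  have hwm : ∀ a, Measurable fun y => ENNReal.ofReal (ζ (s a y)) := fun a =>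
    (hζ.comp (hsm a)).ennreal_ofReal
  have hGae : ∀ᵐ y ∂ρ.restrict I.Y, y ∈ G := by
    rw [ae_restrict_iff' h.measurableSet_Y]
    filter_upwards [measure_eq_zero_iff_ae_notMem.1 hG0] with y hy hyY
    by_contra hyG
    exact hy ⟨hyY, hyG⟩
  refine ⟨G, s, fun a y => ENNReal.ofReal (ζ (s a y)), ?_, fun a y hy => by
    rw [hst a y hy]; exact ⟨hta a a.2 y hy, htF a a.2 y hy⟩⟩
  refine ⟨h.measurable_induced, hsm, hwm, fun a y hy => by rw [hst a y hy]; exact htG a a.2 y hy,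
    hGae, ?_, ?_, ?_⟩
  · intro a x hx y hy
    rw [Real.rpow_neg hβ.le, ← Real.inv_rpow hβ.le,
      ← Real.mul_rpow (inv_pos.2 hβ).le dist_nonneg]
    gcongr
    exact hdist a x hx y hy
  · intro a x hx y hy
    have h1 := (hd a a.2).1 _ (hta a a.2 x hx)
    have h2 := (hd a a.2).1 _ (hta a a.2 y hy)
    have h3 := (hd a a.2).2.2 _ (hta a a.2 x hx) _ (hta a a.2 y hy)
    rw [htF a a.2 x hx, htF a a.2 y hy] at h3
    simp only [hst a x hx, hst a y hy]
    rw [← ENNReal.ofReal_mul (Real.exp_pos _).le]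
    refine ENNReal.ofReal_le_ofReal ?_
    calc ζ (t a x) = Real.exp (Real.log (ζ (t a x)) - Real.log (ζ (t a y))) * ζ (t a y) := by
          rw [Real.exp_sub, Real.exp_log h1, Real.exp_log h2]
          field_simp
      _ ≤ _ := by gcongr; exact (le_abs_self _).trans h3
  · intro f u hf hu
    have hYα : I.Y =ᵐ[ρ] ⋃ a : I.α, (a : Set Λ) := by
      rw [← sUnion_eq_iUnion]
      exact (ae_eq_set.2 ⟨h.cover_Y, by
        rw [sdiff_eq_empty.2 (sUnion_subset h.subset_Y), measure_empty]⟩)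
    rw [setLIntegral_congr hYα, lintegral_iUnion (fun a : I.α => h.measurableSet_α a a.2) fun a b hab =>
      h.disjoint_α a.2 b.2 (Subtype.coe_injective.ne hab)]
    simp only [transferOp]
    have hgm : ∀ a : I.α, Measurable fun y => f (s a y) * ENNReal.ofReal (ζ (s a y)) * u y :=
      fun a => ((hf.comp (hsm a)).mul (hwm a)).mul hu
    simp only [← ENNReal.tsum_mul_right]
    rw [lintegral_tsum fun a => (hgm a).aemeasurable]
    refine tsum_congr fun a => ?_
    have ham := h.measurableSet_α a a.2
    have hinv : Measurable fun x => ENNReal.ofReal (ζ x)⁻¹ := hζ.inv.ennreal_ofReal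
    have hmap := h.map_withDensity a.2 (hd a a.2).2.1
    -- Positivity of the density lets the full-measure property of `G` be pulled back through `F` to
    -- `ρ` on `a`.
    have hac : ρ.restrict a ≪ (ρ.restrict a).withDensity fun x => ENNReal.ofReal (ζ x)⁻¹ := by
      refine withDensity_absolutelyContinuous' hinv.aemeasurable ?_
      filter_upwards [ae_restrict_mem ham] with x hx
      simpa using (hd a a.2).1 x hx
    have hFG : ∀ᵐ x ∂ρ.restrict a, I.induced T x ∈ G := by
      refine hac.ae_le ?_
      rw [← hmap] at hGae
      exact ae_of_ae_map h.measurable_induced.aemeasurable hGae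
    have hgF : Measurable fun x => f (s a (I.induced T x)) *
        ENNReal.ofReal (ζ (s a (I.induced T x))) * u (I.induced T x) :=
      (hgm a).comp h.measurable_induced
    rw [← hmap, lintegral_map (hgm a) h.measurable_induced,
      lintegral_withDensity_eq_lintegral_mul _ hinv hgF]
    refine lintegral_congr_ae ?_
    filter_upwards [hFG, ae_restrict_mem ham] with x hxG hxa
    have hx : s a (I.induced T x) = x := by
      rw [hst a _ hxG]
      exact h.injOn a.2 (hta a a.2 _ hxG) hxa (htF a a.2 _ hxG)
    have hpos := (hd a a.2).1 x hxa
    simp only [Pi.mul_apply, hx]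
    rw [mul_assoc, mul_left_comm, ← mul_assoc (ENNReal.ofReal _) (ENNReal.ofReal _),
      ← ENNReal.ofReal_mul (inv_pos.2 hpos).le, inv_mul_cancel₀ hpos.ne', ENNReal.ofReal_one,
      one_mul]

end IsNonuniformlyExpanding

/-! ### Decay of correlations for the induced map -/

/-- The constants are fixed before `ρ`, `T` and `I`, which is the source of all uniformity in the
family. The functions `φ` and `ψ` need regularity only within partition elements, measured after
applying `F`. One application of the transfer operator brings them into the cone, whence the
exponent `k + 1`. -/
lemma exists_lintegral_decay (Λ : Type*) [MetricSpace Λ] [BoundedSpace Λ] [MeasurableSpace Λ]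
    [BorelSpace Λ] {β C₁ : ℝ} (hβ : 1 < β) (hC : 1 ≤ C₁) {η : ℝ≥0} (hη : 0 < η) :
    ∃ K γ : ℝ, 0 ≤ K ∧ 0 ≤ γ ∧ γ < 1 ∧
      ∀ (ρ : Measure Λ) [IsFiniteMeasure ρ] (T : Λ → Λ) (I : InducingScheme Λ) (ν : Measure Λ),
        IsNonuniformlyExpanding ρ T I β C₁ η → IsInducedMeasure ρ T I ν →
        ∀ φ ψ : Λ → ℝ≥0∞, Measurable φ → Measurable ψ →
          (∀ f ∈ ({φ, ψ} : Set (Λ → ℝ≥0∞)), ∀ a ∈ I.α, ∀ x ∈ a, ∀ y ∈ a, f x ≤ ENNReal.ofReal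
            (Real.exp (C₁ * dist (I.induced T x) (I.induced T y) ^ (η : ℝ))) * f y) →
          ∫⁻ y, φ y ∂ν = ∫⁻ y, ψ y ∂ν → ∫⁻ y, φ y ∂ν ≠ ∞ →
          ∀ (k : ℕ) (u : Λ → ℝ≥0∞), Measurable u →
            ∫⁻ y, φ y * u ((I.induced T)^[k + 1] y) ∂ν ≤
              ∫⁻ y, ψ y * u ((I.induced T)^[k + 1] y) ∂ν +
                ENNReal.ofReal (K * γ ^ k) * (∫⁻ y, φ y ∂ν) * ∫⁻ y, u y ∂ν := by
  obtain ⟨D, hD0, hD⟩ := exists_dist_rpow_le Λ η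
  set θ : ℝ := β ^ (-(η : ℝ))
  have hβ0 : 0 < β := one_pos.trans hβ
  have hθ : 0 ≤ θ := by positivity
  have hθ1 : θ < 1 := Real.rpow_lt_one_of_one_lt_of_neg hβ (neg_neg_of_pos hη)
  have hθ' : 0 < 1 - θ := sub_pos.2 hθ1
  have hC0 : 0 < C₁ := one_pos.trans_le hC
  -- `R0` is a constant for the invariant density `h`. For `f` among `φ`, `ψ`, the image of `h f`
  -- has constant `R0 θ + C₁ + C₁`, from the density, `f` and the weights, which is at most `R`.
  set R0 : ℝ := C₁ / (1 - θ) + 1 with hR0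
  set R : ℝ := 2 * C₁ + R0 with hR
  have hR0' : 0 ≤ R0 := by positivity
  have hRpos : 0 < R := by positivity
  have hR0R : R0 ≤ R := by linarith
  have hRC : R * θ + C₁ < R := by
    have h1 : R0 * (1 - θ) = C₁ + (1 - θ) := by rw [hR0]; field_simp
    have h2 : R0 * (1 - θ) ≤ R * (1 - θ) := by gcongr
    linarith
  set δ : ℝ := (1 - (R * θ + C₁) / R) * Real.exp (-((R * θ + C₁) * D)) with hδ
  have hδ0 : 0 < δ := mul_pos (sub_pos.2 ((div_lt_one hRpos).2 hRC)) (Real.exp_pos _)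
  have hγ : ENNReal.ofReal (1 - δ) = ENNReal.ofReal (max 0 (1 - δ)) := by
    rcases le_total 0 (1 - δ) with h | h
    · rw [max_eq_right h]
    · rw [max_eq_left h, ENNReal.ofReal_of_nonpos h, ENNReal.ofReal_zero]
  refine ⟨Real.exp (R * D) ^ 2, max 0 (1 - δ), by positivity, le_max_left _ _,
    max_lt one_pos (by linarith), ?_⟩
  intro ρ _ T I ν hT hν φ ψ hφ hψ hreg hφψ hφi k u hu
  obtain ⟨G, s, w, H, hs⟩ := hT.exists_fullBranches
  have : Countable I.α := hT.countable_α
  have := hν.isProbabilityMeasure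
  set m := ρ.restrict I.Y
  have hm : m univ ≠ 0 := by
    rw [Measure.restrict_apply_univ]; exact hT.measure_Y_pos.ne'
  have hνh : m.withDensity (ν.rnDeriv m) = ν :=
    Measure.withDensity_rnDeriv_eq _ _ hν.absolutelyContinuous
  have hint : ∀ u : Λ → ℝ≥0∞, Measurable u →
      ∫⁻ x, ν.rnDeriv m x * u x ∂m = ∫⁻ x, u x ∂ν := by
    intro u hu
    conv_rhs => rw [← hνh]
    rw [lintegral_withDensity_eq_lintegral_mul _ (Measure.measurable_rnDeriv ν m) hu]
    rfl
  obtain ⟨h, hh, hhR, hae⟩ := H.exists_logHolder_density (R := R0) hθ hθ1 hC0 hT.η_le_one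
    (by rw [hR0]; linarith) (Measure.measurable_rnDeriv ν m)
    (by simpa using (hint 1 measurable_one).trans_ne (by simp)) fun u hu => by
      rw [hint u hu, hint (fun x => u (I.induced T x)) (hu.comp H.measurable_F)]
      exact hν.invariant.lintegral_comp hu
  have hint' : ∀ u : Λ → ℝ≥0∞, Measurable u → ∫⁻ x, h x * u x ∂m = ∫⁻ x, u x ∂ν := by
    intro u hu
    rw [← hint u hu]
    refine lintegral_congr_ae ?_
    filter_upwards [hae] with x hx
    rw [hx]
  have hhf : ∀ f : Λ → ℝ≥0∞, Measurable f → Measurable fun x => h x * f x := fun f hf => hh.mul hf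
  have hPm : ∀ f : Λ → ℝ≥0∞, Measurable f → Measurable (transferOp s w fun x => h x * f x) :=
    fun f hf => H.measurable_transferOp (hhf f hf)
  have hPR : ∀ f ∈ ({φ, ψ} : Set (Λ → ℝ≥0∞)),
      LogHolder G η R (transferOp s w fun x => h x * f x) := by
    intro f hf
    refine (H.logHolder_transferOp (K := R0 * θ + C₁) fun a =>
      (H.logHolder_comp hR0' hhR a).mul fun x hx y hy => ?_).mono ?_
    · have := hreg f hf a a.2 _ (hs a x hx).1 _ (hs a y hy).1
      rwa [(hs a x hx).2, (hs a y hy).2] at this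
    · have : R0 * θ ≤ R0 * 1 := by gcongr
      linarith
  have hPI : ∀ f : Λ → ℝ≥0∞, Measurable f →
      ∫⁻ x, transferOp s w (fun x => h x * f x) x ∂m = ∫⁻ x, f x ∂ν := fun f hf => by
    rw [H.lintegral_transferOp (hhf f hf), hint' f hf]
  have hPk : ∀ f : Λ → ℝ≥0∞, Measurable f →
      ∫⁻ y, transferOp s w (fun x => h x * f x) y * u ((I.induced T)^[k] y) ∂m =
        ∫⁻ y, f y * u ((I.induced T)^[k + 1] y) ∂ν := by
    intro f hf
    have huk : ∀ k, Measurable fun y => u ((I.induced T)^[k] y) := fun k =>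
      hu.comp (H.measurable_F.iterate k)
    rw [← H.transfer _ (fun y => u ((I.induced T)^[k] y)) (hhf f hf) (huk k),
      ← hint' (fun y => f y * u ((I.induced T)^[k + 1] y)) (hf.mul (huk (k + 1)))]
    simp only [mul_assoc, Function.iterate_succ_apply]
  have key := H.decay hm hD hθ hC0 hRpos.le hRC hδ (hhR.mono hR0R)
    (by simpa using hint' 1 measurable_one) hu hφi k _ _ (hPm φ hφ) (hPm ψ hψ)
    (hPR φ (by simp)) (hPR ψ (by simp)) (hPI φ hφ) (by rw [hPI ψ hψ, hφψ])
  rw [hPk φ hφ, hPk ψ hψ, hint' u hu, hγ] at key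
  refine key.trans_eq ?_
  rw [ENNReal.ofReal_mul (by positivity), ENNReal.ofReal_pow (Real.exp_pos _).le,
    ENNReal.ofReal_pow (le_max_left _ _)]
  ring

/-! ### Induced observables -/

lemma measurable_eval_nat {Λ E : Type*} [MeasurableSpace Λ] [MeasurableSpace E] {u : ℕ → Λ → E}
    (hu : ∀ n, Measurable (u n)) {τ : Λ → ℕ} (hτ : Measurable τ) :
    Measurable fun y => u (τ y) y :=
  (measurable_from_prod_countable_left (f := fun z : Λ × ℕ => u z.2 z.1) hu).comp
    (measurable_id.prodMk hτ)

lemma measurable_birkhoffSum {Λ : Type*} [MeasurableSpace Λ] {T : Λ → Λ} (hT : Measurable T)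
    {v : Λ → ℝ} (hv : Measurable v) (n : ℕ) : Measurable (birkhoffSum T v n) :=
  Finset.measurable_fun_sum _ fun l _ => hv.comp (hT.iterate l)

lemma abs_birkhoffSum_le {Λ : Type*} {T : Λ → Λ} {v : Λ → ℝ} {V : ℝ} (hV : ∀ x, |v x| ≤ V) (n : ℕ)
    (x : Λ) : |birkhoffSum T v n x| ≤ n * V := by
  refine (Finset.abs_sum_le_sum_abs _ _).trans ?_
  refine (Finset.sum_le_sum fun l _ => hV (T^[l] x)).trans_eq ?_
  simp

/-- `v` is bounded by `V`, with `η`-Hölder constant at most `V`. -/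
structure HolderBound {Λ : Type*} [MetricSpace Λ] (η : ℝ≥0) (V : ℝ) (v : Λ → ℝ) : Prop where
  pos : 0 < V
  abs_le : ∀ x, |v x| ≤ V
  abs_sub_le : ∀ x y, |v x - v y| ≤ V * dist x y ^ (η : ℝ)

section InducedDecay

variable {Λ : Type*} [MetricSpace Λ] [MeasurableSpace Λ] {ρ : Measure Λ} {T : Λ → Λ}
  {I : InducingScheme Λ} {β C₁ : ℝ} {η : ℝ≥0} {V : ℝ} {v : Λ → ℝ}

omit [MeasurableSpace Λ] in
lemma HolderBound.holderWith (hv : HolderBound η V v) :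
    HolderWith V.toNNReal η v := fun x y => by
  rw [edist_dist, edist_dist, ENNReal.ofReal_rpow_of_nonneg dist_nonneg η.coe_nonneg,
    ← ENNReal.ofReal, ← ENNReal.ofReal_mul hv.pos.le]
  exact ENNReal.ofReal_le_ofReal (hv.abs_sub_le x y)

omit [MeasurableSpace Λ] in
lemma HolderBound.continuous (hv : HolderBound η V v) (hη : 0 < η) : Continuous v :=
  hv.holderWith.continuous hη

/-- After the shift by `2 V` each summand is at least `V`, so its oscillation `V t` is at most `t`
times itself and the log-Hölder constant does not depend on `V`. The intermediate bound gives `C₁^η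
≤ C₁`. -/
lemma IsNonuniformlyExpanding.birkhoffSum_add_le (hT : IsNonuniformlyExpanding ρ T I β C₁ η)
    (hv : HolderBound η V v) {a : Set Λ} (ha : a ∈ I.α) {x y : Λ} (hx : x ∈ a) (hy : y ∈ a) :
    birkhoffSum T v (I.τ x) x + 2 * V * I.τ x ≤
      Real.exp (C₁ * dist (I.induced T x) (I.induced T y) ^ (η : ℝ)) *
        (birkhoffSum T v (I.τ y) y + 2 * V * I.τ y) := by
  rw [← hT.τ_const a ha x hx y hy]
  set t := C₁ * dist (I.induced T x) (I.induced T y) ^ (η : ℝ)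
  have hC0 : 0 ≤ C₁ := zero_le_one.trans hT.one_le_C₁
  have hsum : ∀ z, birkhoffSum T v (I.τ x) z + 2 * V * I.τ x =
      ∑ l ∈ Finset.range (I.τ x), (v (T^[l] z) + 2 * V) := fun z => by
    rw [Finset.sum_add_distrib, birkhoffSum]
    simp [mul_comm]
  rw [hsum, hsum, Finset.mul_sum]
  refine Finset.sum_le_sum fun l hl => ?_
  have h1 : dist (T^[l] x) (T^[l] y) ^ (η : ℝ) ≤ t :=
    calc dist (T^[l] x) (T^[l] y) ^ (η : ℝ)
        ≤ (C₁ * dist (I.induced T x) (I.induced T y)) ^ (η : ℝ) := by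
          gcongr
          exact hT.intermediate a ha x hx y hy l (Finset.mem_range.1 hl)
      _ = C₁ ^ (η : ℝ) * dist (I.induced T x) (I.induced T y) ^ (η : ℝ) :=
          Real.mul_rpow hC0 dist_nonneg
      _ ≤ t := by
          refine mul_le_mul_of_nonneg_right ?_ (by positivity)
          exact (Real.rpow_le_rpow_of_exponent_le hT.one_le_C₁
            (by exact_mod_cast hT.η_le_one)).trans_eq (Real.rpow_one _)
  have h2 : v (T^[l] x) ≤ v (T^[l] y) + V * t := by
    have := (hv.abs_sub_le (T^[l] x) (T^[l] y)).trans (mul_le_mul_of_nonneg_left h1 hv.pos.le)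
    linarith [le_abs_self (v (T^[l] x) - v (T^[l] y))]
  have h3 : V ≤ v (T^[l] y) + 2 * V := by linarith [neg_abs_le (v (T^[l] y)), hv.abs_le (T^[l] y)]
  have ht : 0 ≤ t := by positivity
  calc v (T^[l] x) + 2 * V ≤ (v (T^[l] y) + 2 * V) + V * t := by linarith
    _ ≤ (v (T^[l] y) + 2 * V) + (v (T^[l] y) + 2 * V) * t := by gcongr
    _ = (t + 1) * (v (T^[l] y) + 2 * V) := by ring
    _ ≤ _ := by
      have := hv.pos.le.trans h3
      gcongr
      exact Real.add_one_le_exp t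

/-- The signed induced observable `B` is the difference of `B + 2 V τ` and `2 V τ`, which are
nonnegative, regular on partition elements and, as `B` has mean zero, of equal integral. -/
lemma exists_decay (Λ : Type*) [MetricSpace Λ] [BoundedSpace Λ] [MeasurableSpace Λ]
    [BorelSpace Λ] {β C₁ : ℝ} (hβ : 1 < β) (hC : 1 ≤ C₁) {η : ℝ≥0} (hη : 0 < η) :
    ∃ K γ : ℝ, 0 ≤ K ∧ 0 ≤ γ ∧ γ < 1 ∧
      ∀ (ρ : Measure Λ) [IsFiniteMeasure ρ] (T : Λ → Λ) (I : InducingScheme Λ) (ν : Measure Λ),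
        IsNonuniformlyExpanding ρ T I β C₁ η → IsInducedMeasure ρ T I ν →
        Integrable (fun y => (I.τ y : ℝ)) ν → ∀ (V : ℝ) (v : Λ → ℝ), HolderBound η V v →
        ∫ y, birkhoffSum T v (I.τ y) y ∂ν = 0 →
        ∀ (k : ℕ) (g : Λ → ℝ), Measurable g → Integrable g ν →
          Integrable (fun y => (I.τ y : ℝ) * g ((I.induced T)^[k + 1] y)) ν →
          |∫ y, birkhoffSum T v (I.τ y) y * g ((I.induced T)^[k + 1] y) ∂ν| ≤
            K * γ ^ k * V * (∫ y, (I.τ y : ℝ) ∂ν) * ∫ y, |g y| ∂ν := by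
  obtain ⟨K, γ, hK, hγ0, hγ1, hdec⟩ := exists_lintegral_decay Λ hβ hC hη
  refine ⟨2 * K, γ, by positivity, hγ0, hγ1, ?_⟩
  intro ρ _ T I ν hT hν hτ V v hv hv0 k g hg hgi hτg
  have hFm := hT.measurable_induced
  have hTm := hT.nonsingular.measurable
  have hτm : Measurable fun y => (I.τ y : ℝ) := measurable_from_nat.comp hT.measurable_τ
  have hvm : Measurable v := (hv.continuous hη).measurable
  have hV := hv.pos
  set B : Λ → ℝ := fun y => birkhoffSum T v (I.τ y) y with hB
  have hBm : Measurable B := measurable_eval_nat (measurable_birkhoffSum hTm hvm) hT.measurable_τ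
  have hBτ : ∀ y, |B y| ≤ I.τ y * V := fun y => abs_birkhoffSum_le hv.abs_le _ _
  have hBi : Integrable B ν := (hτ.mul_const V).mono' hBm.aestronglyMeasurable (.of_forall hBτ)
  have hB0 : ∀ y, 0 ≤ B y + 2 * V * I.τ y := fun y => by
    have h1 := neg_abs_le (B y)
    have h2 : 0 ≤ (I.τ y : ℝ) * V := by positivity
    linarith [hBτ y]
  set tb := ∫ y, (I.τ y : ℝ) ∂ν
  have htb : 0 ≤ tb := integral_nonneg fun y => Nat.cast_nonneg _
  set φ : Λ → ℝ≥0∞ := fun y => ENNReal.ofReal (B y + 2 * V * I.τ y) with hφ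
  set ψ : Λ → ℝ≥0∞ := fun y => ENNReal.ofReal (2 * V * I.τ y) with hψ
  have hφm : Measurable φ := (hBm.add (hτm.const_mul _)).ennreal_ofReal
  have hψm : Measurable ψ := (hτm.const_mul _).ennreal_ofReal
  have hφI : ∫⁻ y, φ y ∂ν = ENNReal.ofReal (2 * V * tb) := by
    refine (ofReal_integral_eq_lintegral_ofReal (f := fun y => B y + 2 * V * I.τ y)
      (hBi.add (hτ.const_mul _)) (.of_forall hB0)).symm.trans ?_
    rw [integral_add hBi (hτ.const_mul _), hv0, zero_add, integral_const_mul]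
  have hψI : ∫⁻ y, ψ y ∂ν = ENNReal.ofReal (2 * V * tb) := by
    refine (ofReal_integral_eq_lintegral_ofReal (hτ.const_mul (2 * V))
      (.of_forall fun y => by positivity)).symm.trans ?_
    rw [integral_const_mul]
  have hreg : ∀ f ∈ ({φ, ψ} : Set (Λ → ℝ≥0∞)), ∀ a ∈ I.α, ∀ x ∈ a, ∀ y ∈ a,
      f x ≤ ENNReal.ofReal
        (Real.exp (C₁ * dist (I.induced T x) (I.induced T y) ^ (η : ℝ))) * f y := by
    rintro f (rfl | rfl) a ha x hx y hy
    · simp only [hφ]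
      rw [← ENNReal.ofReal_mul (Real.exp_pos _).le]
      exact ENNReal.ofReal_le_ofReal (hT.birkhoffSum_add_le hv ha hx hy)
    · simp only [hψ]
      rw [← ENNReal.ofReal_mul (Real.exp_pos _).le, hT.τ_const a ha x hx y hy]
      refine ENNReal.ofReal_le_ofReal (le_mul_of_one_le_left (by positivity) ?_)
      exact Real.one_le_exp (by have := hT.one_le_C₁; positivity)
  have hnonneg : ∀ g : Λ → ℝ, Measurable g → (∀ y, 0 ≤ g y) → Integrable g ν →
      Integrable (fun y => (I.τ y : ℝ) * g ((I.induced T)^[k + 1] y)) ν →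
      Integrable (fun y => B y * g ((I.induced T)^[k + 1] y)) ν ∧
      |∫ y, B y * g ((I.induced T)^[k + 1] y) ∂ν| ≤ 2 * K * γ ^ k * V * tb * ∫ y, g y ∂ν := by
    intro g hg hg0 hgi hτg
    have hgF : Measurable fun y => g ((I.induced T)^[k + 1] y) := hg.comp (hFm.iterate _)
    have hBg : Integrable (fun y => B y * g ((I.induced T)^[k + 1] y)) ν := by
      refine (hτg.mul_const V).mono' (hBm.mul hgF).aestronglyMeasurable (.of_forall fun y => ?_)
      rw [Real.norm_eq_abs, abs_mul, abs_of_nonneg (hg0 _), mul_right_comm]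
      exact mul_le_mul_of_nonneg_right (hBτ y) (hg0 _)
    refine ⟨hBg, ?_⟩
    have hI : ∫⁻ y, ENNReal.ofReal (g y) ∂ν = ENNReal.ofReal (∫ y, g y ∂ν) :=
      (ofReal_integral_eq_lintegral_ofReal hgi (.of_forall hg0)).symm
    have hψi := hτg.const_mul (2 * V)
    have h1 : ∫⁻ y, ψ y * ENNReal.ofReal (g ((I.induced T)^[k + 1] y)) ∂ν =
        ENNReal.ofReal (∫ y, 2 * V * (I.τ y * g ((I.induced T)^[k + 1] y)) ∂ν) := by
      rw [ofReal_integral_eq_lintegral_ofReal hψi (.of_forall fun y => by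
        have := hg0 ((I.induced T)^[k + 1] y); positivity)]
      refine lintegral_congr fun y => ?_
      rw [hψ, ← ENNReal.ofReal_mul (by positivity), mul_assoc]
    have h2 : ∫⁻ y, φ y * ENNReal.ofReal (g ((I.induced T)^[k + 1] y)) ∂ν =
        ENNReal.ofReal (∫ y, B y * g ((I.induced T)^[k + 1] y) ∂ν +
          ∫ y, 2 * V * (I.τ y * g ((I.induced T)^[k + 1] y)) ∂ν) := by
      rw [← integral_add hBg hψi, ofReal_integral_eq_lintegral_ofReal
        (f := fun y => B y * g ((I.induced T)^[k + 1] y) +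
          2 * V * (I.τ y * g ((I.induced T)^[k + 1] y))) (hBg.add hψi)
        (.of_forall fun y => by
          have := mul_nonneg (hB0 y) (hg0 ((I.induced T)^[k + 1] y))
          simp only [Pi.zero_apply]
          linarith)]
      refine lintegral_congr fun y => ?_
      rw [hφ, ← ENNReal.ofReal_mul (hB0 y)]
      congr 1
      ring
    -- The one-sided estimate is used in both orders, giving the upper and the lower bound on the
    -- correlation.
    have hd1 := hdec ρ T I ν hT hν φ ψ hφm hψm hreg (hφI.trans hψI.symm) (by simp [hφI]) k
      (fun y => ENNReal.ofReal (g y)) hg.ennreal_ofReal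
    have hd2 := hdec ρ T I ν hT hν ψ φ hψm hφm (by rwa [pair_comm]) (hψI.trans hφI.symm)
      (by simp [hψI]) k (fun y => ENNReal.ofReal (g y)) hg.ennreal_ofReal
    have hg0' : 0 ≤ ∫ y, g y ∂ν := integral_nonneg hg0
    set b := ∫ y, B y * g ((I.induced T)^[k + 1] y) ∂ν
    set c := ∫ y, 2 * V * (I.τ y * g ((I.induced T)^[k + 1] y)) ∂ν
    have hc : 0 ≤ c := integral_nonneg fun y => by
      have := hg0 ((I.induced T)^[k + 1] y); positivity
    have hbc : 0 ≤ b + c := by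
      rw [← integral_add hBg hψi]
      refine integral_nonneg fun y => ?_
      have := mul_nonneg (hB0 y) (hg0 ((I.induced T)^[k + 1] y))
      simp only [Pi.zero_apply]
      linarith
    rw [h1, h2, hI, hφI, ← ENNReal.ofReal_mul (by positivity), ← ENNReal.ofReal_mul (by positivity),
      ← ENNReal.ofReal_add hc (by positivity), ENNReal.ofReal_le_ofReal_iff (by positivity)] at hd1
    rw [h1, h2, hI, hψI, ← ENNReal.ofReal_mul (by positivity), ← ENNReal.ofReal_mul (by positivity),
      ← ENNReal.ofReal_add hbc (by positivity), ENNReal.ofReal_le_ofReal_iff (by positivity)] at hd2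
    rw [abs_le]
    constructor <;> linarith
  have hp := hnonneg (fun y => max (g y) 0) (hg.max measurable_const) (fun y => le_max_right _ _)
    hgi.pos_part (hτg.abs.mono' (hτm.mul ((hg.max measurable_const).comp
      (hFm.iterate _))).aestronglyMeasurable (.of_forall fun y => by
        rw [Real.norm_eq_abs, abs_mul, abs_mul]
        refine mul_le_mul_of_nonneg_left ?_ (abs_nonneg _)
        rw [abs_of_nonneg (le_max_right _ _)]
        exact max_le (le_abs_self _) (abs_nonneg _)))
  have hn := hnonneg (fun y => max (-g y) 0) (hg.neg.max measurable_const)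
    (fun y => le_max_right _ _)
    hgi.neg_part (hτg.abs.mono' (hτm.mul ((hg.neg.max measurable_const).comp
      (hFm.iterate _))).aestronglyMeasurable (.of_forall fun y => by
        rw [Real.norm_eq_abs, abs_mul, abs_mul]
        refine mul_le_mul_of_nonneg_left ?_ (abs_nonneg _)
        rw [abs_of_nonneg (le_max_right _ _)]
        exact max_le (neg_le_abs _) (abs_nonneg _)))
  have hsplit : ∫ y, B y * g ((I.induced T)^[k + 1] y) ∂ν =
      ∫ y, B y * max (g ((I.induced T)^[k + 1] y)) 0 ∂ν -
        ∫ y, B y * max (-g ((I.induced T)^[k + 1] y)) 0 ∂ν := by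
    rw [← integral_sub hp.1 hn.1]
    congr 1 with y
    rw [← mul_sub, max_zero_sub_max_neg_zero_eq_self]
  have habs : ∫ y, |g y| ∂ν = ∫ y, max (g y) 0 ∂ν + ∫ y, max (-g y) 0 ∂ν := by
    rw [← integral_add hgi.pos_part hgi.neg_part]
    congr 1 with y
    rw [max_zero_add_max_neg_zero_eq_abs_self]
  rw [hsplit, habs, mul_add]
  exact (abs_sub _ _).trans (add_le_add hp.2 hn.2)

end InducedDecay

/-! ### The projected measure and the Green-Kubo functional -/

/-- The properties of the inducing scheme and of the measure on its base which are used on the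
tower. -/
structure TowerData {Λ : Type*} [MeasurableSpace Λ] (T : Λ → Λ) (I : InducingScheme Λ)
    (ν : Measure Λ) : Prop where
  measurable_T : Measurable T
  measurableSet_Y : MeasurableSet I.Y
  measurable_τ : Measurable I.τ
  isProbabilityMeasure : IsProbabilityMeasure ν
  ae_mem : ∀ᵐ y ∂ν, y ∈ I.Y
  ae_one_le : ∀ᵐ y ∂ν, 1 ≤ I.τ y
  invariant : MeasurePreserving (I.induced T) ν ν
  integrable_sq : Integrable (fun y => (I.τ y : ℝ) ^ 2) ν

/-- The value at `b` of the functional `b ↦ ∫ χ b dμ_Δ`, where `χ` is the coboundary part of the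
martingale-coboundary decomposition of `v` on the tower. -/
def greenKubo {Λ : Type*} [MeasurableSpace Λ] (T : Λ → Λ) (I : InducingScheme Λ) (ν : Measure Λ)
    (v b : Λ → ℝ) : ℝ :=
  (∫ y, (I.τ y : ℝ) ∂ν)⁻¹ *
    (∑' k : ℕ, ∫ y, birkhoffSum T v (I.τ y) y *
        birkhoffSum T b (I.τ ((I.induced T)^[k + 1] y)) ((I.induced T)^[k + 1] y) ∂ν +
      ∫ y, ∑ l ∈ Finset.range (I.τ y), birkhoffSum T v l y * b (T^[l] y) ∂ν)

/-- Exponential decay of the correlations of the induced observable of `v`. -/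
structure DecayBound {Λ : Type*} [MeasurableSpace Λ] (T : Λ → Λ) (I : InducingScheme Λ)
    (ν : Measure Λ) (v : Λ → ℝ) (A γ : ℝ) : Prop where
  nonneg : 0 ≤ A
  rate_nonneg : 0 ≤ γ
  rate_lt_one : γ < 1
  bound : ∀ (k : ℕ) (g : Λ → ℝ), Measurable g → Integrable g ν →
    Integrable (fun y => (I.τ y : ℝ) * g ((I.induced T)^[k + 1] y)) ν →
    |∫ y, birkhoffSum T v (I.τ y) y * g ((I.induced T)^[k + 1] y) ∂ν| ≤ A * γ ^ k * ∫ y, |g y| ∂ν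

/-- Summation by parts along an orbit, with `S_l v` as the discrete primitive of `v`. -/
lemma sum_mul_eq_abel {Λ : Type*} (T : Λ → Λ) (v b : Λ → ℝ) (n : ℕ) (y : Λ) :
    birkhoffSum T (fun x => v x * b (T x)) n y =
      ∑ l ∈ Finset.range n, birkhoffSum T v l y * b (T^[l] y) -
        ∑ l ∈ Finset.range n, birkhoffSum T v l y * b (T (T^[l] y)) +
          birkhoffSum T v n y * b (T^[n] y) := by
  induction n with
  | zero => simp [birkhoffSum]
  | succ n ih =>
    rw [birkhoffSum_succ, ih, Finset.sum_range_succ, Finset.sum_range_succ, birkhoffSum_succ,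
      Function.iterate_succ_apply']
    ring

lemma birkhoffSum_comp_self {Λ : Type*} (T : Λ → Λ) (b : Λ → ℝ) (n : ℕ) (y : Λ) :
    birkhoffSum T (fun x => b (T x)) n y = birkhoffSum T b n y + b (T^[n] y) - b y := by
  induction n with
  | zero => simp [birkhoffSum]
  | succ n ih =>
    rw [birkhoffSum_succ, ih, birkhoffSum_succ, Function.iterate_succ_apply']
    ring

/-! ### Integrability on the base and integration against the projected measure. -/

namespace TowerData

variable {Λ : Type*} [MeasurableSpace Λ] {T : Λ → Λ} {I : InducingScheme Λ} {ν : Measure Λ}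
  {v b : Λ → ℝ} {V W A γ : ℝ}

lemma measurable_F (H : TowerData T I ν) : Measurable (I.induced T) :=
  InducingScheme.measurable_induced H.measurable_T H.measurable_τ

lemma measurable_τ_real (H : TowerData T I ν) : Measurable fun y => (I.τ y : ℝ) :=
  measurable_from_nat.comp H.measurable_τ

lemma integrable_of_abs_le (H : TowerData T I ν) {g : Λ → ℝ} (hg : Measurable g)
    (hgW : ∀ y, |g y| ≤ W * (I.τ y : ℝ) ^ 2) : Integrable g ν :=
  (H.integrable_sq.const_mul W).mono' hg.aestronglyMeasurable (.of_forall hgW)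

lemma integrable_of_abs_le' (H : TowerData T I ν) {g : Λ → ℝ} (hg : Measurable g) (hW : 0 ≤ W)
    (hgW : ∀ y, |g y| ≤ W * I.τ y) : Integrable g ν :=
  H.integrable_of_abs_le hg fun y => (hgW y).trans (by
    gcongr
    exact_mod_cast Nat.le_self_pow two_ne_zero _)

lemma integrable_τ (H : TowerData T I ν) : Integrable (fun y => (I.τ y : ℝ)) ν :=
  H.integrable_of_abs_le' H.measurable_τ_real zero_le_one fun y => by simp

lemma integrable_bdd (H : TowerData T I ν) (hb : Measurable b) (hbW : ∀ x, |b x| ≤ W) :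
    Integrable b ν :=
  have := H.isProbabilityMeasure
  (integrable_const W).mono' hb.aestronglyMeasurable (.of_forall hbW)

lemma one_le_integral_τ (H : TowerData T I ν) : 1 ≤ ∫ y, (I.τ y : ℝ) ∂ν := by
  have := H.isProbabilityMeasure
  calc (1 : ℝ) = ∫ _, (1 : ℝ) ∂ν := by simp
    _ ≤ _ := integral_mono_ae (integrable_const _) H.integrable_τ
      (H.ae_one_le.mono fun y hy => Nat.one_le_cast.2 hy)

lemma measurable_ind (H : TowerData T I ν) (hb : Measurable b) :
    Measurable fun y => birkhoffSum T b (I.τ y) y :=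
  measurable_eval_nat (measurable_birkhoffSum H.measurable_T hb) H.measurable_τ

omit [MeasurableSpace Λ] in
lemma abs_ind_le (hbW : ∀ x, |b x| ≤ W) (y : Λ) : |birkhoffSum T b (I.τ y) y| ≤ W * I.τ y := by
  rw [mul_comm]
  exact abs_birkhoffSum_le hbW _ _

lemma integrable_ind (H : TowerData T I ν) (hb : Measurable b) (hW : 0 ≤ W)
    (hbW : ∀ x, |b x| ≤ W) : Integrable (fun y => birkhoffSum T b (I.τ y) y) ν :=
  H.integrable_of_abs_le' (H.measurable_ind hb) hW (abs_ind_le hbW)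

lemma measurable_tri (H : TowerData T I ν) (hv : Measurable v) (hb : Measurable b) :
    Measurable fun y => ∑ l ∈ Finset.range (I.τ y), birkhoffSum T v l y * b (T^[l] y) :=
  measurable_eval_nat (u := fun n y => ∑ l ∈ Finset.range n, birkhoffSum T v l y * b (T^[l] y))
    (fun _ => Finset.measurable_fun_sum _ fun l _ =>
      (measurable_birkhoffSum H.measurable_T hv l).mul (hb.comp (H.measurable_T.iterate l)))
    H.measurable_τ

omit [MeasurableSpace Λ] in
lemma abs_tri_le (hV : ∀ x, |v x| ≤ V) (y : Λ) :
    |∑ l ∈ Finset.range (I.τ y), birkhoffSum T v l y * b (T^[l] y)| ≤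
      V * (I.τ y * birkhoffSum T (fun x => |b x|) (I.τ y) y) := by
  have hV0 : 0 ≤ V := (abs_nonneg _).trans (hV y)
  rw [← mul_assoc, birkhoffSum, Finset.mul_sum]
  refine (Finset.abs_sum_le_sum_abs _ _).trans (Finset.sum_le_sum fun l hl => ?_)
  rw [abs_mul]
  refine mul_le_mul_of_nonneg_right ((abs_birkhoffSum_le hV l y).trans ?_) (abs_nonneg _)
  rw [mul_comm]
  gcongr
  exact (Finset.mem_range.1 hl).le

lemma integrable_tri (H : TowerData T I ν) (hv : Measurable v) (hb : Measurable b)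
    (hV : ∀ x, |v x| ≤ V) (hbW : ∀ x, |b x| ≤ W) :
    Integrable (fun y => ∑ l ∈ Finset.range (I.τ y), birkhoffSum T v l y * b (T^[l] y)) ν := by
  refine H.integrable_of_abs_le (W := V * W) (H.measurable_tri hv hb) fun y => ?_
  have hV0 : 0 ≤ V := (abs_nonneg _).trans (hV y)
  refine (abs_tri_le hV y).trans ?_
  have := (le_abs_self _).trans
    (abs_ind_le (T := T) (I := I) (b := fun x => |b x|) (fun x => (abs_abs (b x)).trans_le (hbW x)) y)
  calc _ ≤ V * (I.τ y * (W * I.τ y)) := by gcongr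
    _ = _ := by ring

lemma integrable_τ_mul (H : TowerData T I ν) {g : Λ → ℝ} (hg : Measurable g)
    (hgW : ∀ y, |g y| ≤ W * I.τ y) (k : ℕ) :
    Integrable (fun y => (I.τ y : ℝ) * g ((I.induced T)^[k] y)) ν := by
  have hFk := H.invariant.iterate k
  have h2 : Integrable (fun y => (I.τ ((I.induced T)^[k] y) : ℝ) ^ 2) ν :=
    hFk.integrable_comp_of_integrable H.integrable_sq
  refine ((H.integrable_sq.add h2).const_mul W).mono'
    (H.measurable_τ_real.mul (hg.comp hFk.measurable)).aestronglyMeasurable (.of_forall fun y => ?_)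
  rw [Real.norm_eq_abs, abs_mul, Nat.abs_cast, Pi.add_apply]
  set a : ℝ := (I.τ y : ℝ)
  have hc := hgW ((I.induced T)^[k] y)
  set c : ℝ := (I.τ ((I.induced T)^[k] y) : ℝ)
  have ha0 : 0 ≤ a := Nat.cast_nonneg _
  have hc0 : 0 ≤ c := Nat.cast_nonneg _
  rcases le_or_gt 0 W with hW | hW
  · calc a * |g ((I.induced T)^[k] y)| ≤ a * (W * c) := by gcongr
      _ = W * (a * c) := by ring
      _ ≤ W * (a ^ 2 + c ^ 2) := by gcongr; nlinarith [sq_nonneg (a - c)]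
  -- A negative `W` forces both return times to vanish, so the bound still holds.
  · have h0 : c = 0 := by
      by_contra hne
      have : 0 < c := lt_of_le_of_ne hc0 (Ne.symm hne)
      nlinarith [abs_nonneg (g ((I.induced T)^[k] y))]
    have hn := hgW y
    have h0' : a = 0 := by
      by_contra hne
      have : 0 < a := lt_of_le_of_ne ha0 (Ne.symm hne)
      nlinarith [abs_nonneg (g y)]
    simp [h0, h0']

lemma measurable_tower (H : TowerData T I ν) : MeasurableSet I.tower :=
  (measurable_fst H.measurableSet_Y).inter
    (measurableSet_lt measurable_snd (H.measurable_τ.comp measurable_fst))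

lemma lintegral_projected (H : TowerData T I ν) {f : Λ → ℝ≥0∞} (hf : Measurable f) :
    ∫⁻ x, f x ∂(I.projectedMeasure T ν) = (∫⁻ y, (I.τ y : ℝ≥0∞) ∂ν)⁻¹ *
      ∫⁻ y, ∑ l ∈ Finset.range (I.τ y), f (T^[l] y) ∂ν := by
  have := H.isProbabilityMeasure
  have hfT : Measurable fun z : Λ × ℕ => f (T^[z.2] z.1) :=
    hf.comp (measurable_iterate_prod H.measurable_T)
  rw [InducingScheme.projectedMeasure, lintegral_map hf (measurable_iterate_prod H.measurable_T),
    InducingScheme.towerMeasure, lintegral_smul_measure, smul_eq_mul,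
    ← lintegral_indicator H.measurable_tower,
    lintegral_prod _ (hfT.indicator H.measurable_tower).aemeasurable]
  congr 1
  refine lintegral_congr_ae ?_
  filter_upwards [H.ae_mem] with y hy
  rw [lintegral_count, tsum_eq_sum (s := Finset.range (I.τ y))]
  · refine Finset.sum_congr rfl fun l hl => ?_
    exact indicator_of_mem (show (y, l) ∈ I.tower from ⟨hy, Finset.mem_range.1 hl⟩) _
  · intro l hl
    exact indicator_of_notMem (fun h => hl (Finset.mem_range.2 h.2)) _

lemma integral_projected (H : TowerData T I ν) (hμ : IsProbabilityMeasure (I.projectedMeasure T ν))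
    (hb : Measurable b) (hbW : ∀ x, |b x| ≤ W) :
    ∫ x, b x ∂(I.projectedMeasure T ν) =
      (∫ y, (I.τ y : ℝ) ∂ν)⁻¹ * ∫ y, birkhoffSum T b (I.τ y) y ∂ν := by
  have htb := H.one_le_integral_τ
  set tb := ∫ y, (I.τ y : ℝ) ∂ν with htb_def
  have htb0 : 0 < tb := one_pos.trans_le htb
  have hnonneg : ∀ (f : Λ → ℝ) (W : ℝ), Measurable f → (∀ x, 0 ≤ f x) → (∀ x, |f x| ≤ W) → 0 ≤ W →
      ∫ x, f x ∂(I.projectedMeasure T ν) = tb⁻¹ * ∫ y, birkhoffSum T f (I.τ y) y ∂ν := by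
    intro f W hf hf0 hfW hW
    have hτ : ∫⁻ y, (I.τ y : ℝ≥0∞) ∂ν = ENNReal.ofReal tb := by
      rw [htb_def, ofReal_integral_eq_lintegral_ofReal H.integrable_τ
        (.of_forall fun y => Nat.cast_nonneg _)]
      simp
    have hB0 : ∀ y, 0 ≤ birkhoffSum T f (I.τ y) y := fun y => Finset.sum_nonneg fun l _ => hf0 _
    rw [integral_eq_lintegral_of_nonneg_ae (.of_forall hf0) hf.aestronglyMeasurable,
      H.lintegral_projected hf.ennreal_ofReal, hτ,
      integral_eq_lintegral_of_nonneg_ae (.of_forall hB0)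
        (H.measurable_ind hf).aestronglyMeasurable, ENNReal.toReal_mul, ENNReal.toReal_inv,
      ENNReal.toReal_ofReal htb0.le]
    congr 3 with y
    rw [birkhoffSum, ENNReal.ofReal_sum_of_nonneg fun l _ => hf0 _]
  have := H.isProbabilityMeasure
  obtain ⟨x0⟩ : Nonempty Λ := nonempty_of_isProbabilityMeasure ν
  have hW : 0 ≤ W := (abs_nonneg _).trans (hbW x0)
  -- A bounded `b` is shifted by `W` to become nonnegative. The contribution of `W` cancels because
  -- its induced integral is `W` times the mean return time.
  have h1 := hnonneg (fun x => b x + W) (W + W) (hb.add_const W)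
    (fun x => by linarith [neg_abs_le (b x), hbW x])
    (fun x => (abs_add_le _ _).trans (add_le_add (hbW x) (abs_of_nonneg hW).le)) (by linarith)
  have hbi : Integrable b (I.projectedMeasure T ν) :=
    (integrable_const W).mono' hb.aestronglyMeasurable (.of_forall hbW)
  rw [integral_add hbi (integrable_const W)] at h1
  have h2 : ∀ y, birkhoffSum T (fun x => b x + W) (I.τ y) y =
      birkhoffSum T b (I.τ y) y + I.τ y * W := fun y => by
    simp [birkhoffSum, Finset.sum_add_distrib]
  simp only [h2] at h1
  rw [integral_add (H.integrable_ind hb hW hbW) (H.integrable_τ.mul_const W),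
    integral_mul_const, mul_add, ← mul_assoc, inv_mul_cancel₀ htb0.ne'] at h1
  simp only [integral_const, probReal_univ, one_smul, one_mul] at h1
  linarith

lemma integral_comp_induced (H : TowerData T I ν) (hb : Measurable b) :
    ∫ y, b (I.induced T y) ∂ν = ∫ y, b y ∂ν := by
  conv_rhs => rw [← H.invariant.map_eq]
  rw [integral_map H.measurable_F.aemeasurable hb.aestronglyMeasurable]

/-- Along a fibre of the tower the sums of `b ∘ T` and `b` differ by `b ∘ F - b`, which has zero
integral. -/
lemma integral_comp (H : TowerData T I ν) (hμ : IsProbabilityMeasure (I.projectedMeasure T ν))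
    (hb : Measurable b) (hbW : ∀ x, |b x| ≤ W) :
    ∫ x, b (T x) ∂(I.projectedMeasure T ν) = ∫ x, b x ∂(I.projectedMeasure T ν) := by
  have := H.isProbabilityMeasure
  obtain ⟨x0⟩ : Nonempty Λ := nonempty_of_isProbabilityMeasure ν
  have hW : 0 ≤ W := (abs_nonneg _).trans (hbW x0)
  rw [H.integral_projected hμ (b := fun x => b (T x)) (hb.comp H.measurable_T) (fun x => hbW (T x)),
    H.integral_projected hμ hb hbW]
  congr 1
  have hbi := H.integrable_bdd hb hbW
  have hbF : Integrable (fun y => b (I.induced T y)) ν :=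
    H.invariant.integrable_comp_of_integrable hbi
  have h1 : ∀ y, birkhoffSum T (fun x => b (T x)) (I.τ y) y =
      birkhoffSum T b (I.τ y) y + b (I.induced T y) - b y := fun y =>
    birkhoffSum_comp_self T b (I.τ y) y
  have hs : Integrable (fun y => birkhoffSum T b (I.τ y) y + b (I.induced T y)) ν :=
    (H.integrable_ind hb hW hbW).add hbF
  simp only [h1]
  rw [integral_sub hs hbi,
    integral_add (H.integrable_ind hb hW hbW) hbF,
    H.integral_comp_induced hb]
  ring

lemma integral_comp_iterate (H : TowerData T I ν)
    (hμ : IsProbabilityMeasure (I.projectedMeasure T ν))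
    (hb : Measurable b) (hbW : ∀ x, |b x| ≤ W) (k : ℕ) :
    ∫ x, b (T^[k] x) ∂(I.projectedMeasure T ν) = ∫ x, b x ∂(I.projectedMeasure T ν) := by
  induction k with
  | zero => rfl
  | succ k ih =>
    simp only [Function.iterate_succ_apply]
    rw [H.integral_comp hμ (b := fun x => b (T^[k] x)) (hb.comp (H.measurable_T.iterate k))
      fun x => hbW _, ih]

end TowerData

/-! ### The coboundary identity and bounds for the Green-Kubo functional. -/

namespace TowerData

variable {Λ : Type*} [MeasurableSpace Λ] {T : Λ → Λ} {I : InducingScheme Λ} {ν : Measure Λ}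
  {v b b' : Λ → ℝ} {V W W' A γ : ℝ}

lemma integrable_corr (H : TowerData T I ν) (hv : Measurable v) (hV : ∀ x, |v x| ≤ V)
    {g : Λ → ℝ} (hg : Measurable g) (hgW : ∀ y, |g y| ≤ W * I.τ y) (k : ℕ) :
    Integrable (fun y => birkhoffSum T v (I.τ y) y * g ((I.induced T)^[k] y)) ν := by
  refine ((H.integrable_τ_mul (W := W) hg.abs (fun y => (abs_abs (g y)).trans_le (hgW y))
    k).const_mul V).mono' ((H.measurable_ind hv).mul
      (hg.comp (H.measurable_F.iterate k))).aestronglyMeasurable (.of_forall fun y => ?_)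
  rw [Real.norm_eq_abs, abs_mul, ← mul_assoc]
  exact mul_le_mul_of_nonneg_right (abs_ind_le hV y) (abs_nonneg _)

lemma abs_corr_le (H : TowerData T I ν) (hd : DecayBound T I ν v A γ)
    {g : Λ → ℝ} (hg : Measurable g) (hW : 0 ≤ W) (hgW : ∀ y, |g y| ≤ W * I.τ y) (k : ℕ) :
    |∫ y, birkhoffSum T v (I.τ y) y * g ((I.induced T)^[k + 1] y) ∂ν| ≤
      A * γ ^ k * ∫ y, |g y| ∂ν :=
  hd.bound k g hg (H.integrable_of_abs_le' hg hW hgW) (H.integrable_τ_mul hg hgW (k + 1))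

lemma summable_corr (H : TowerData T I ν) (hd : DecayBound T I ν v A γ)
    {g : Λ → ℝ} (hg : Measurable g) (hW : 0 ≤ W) (hgW : ∀ y, |g y| ≤ W * I.τ y) :
    Summable fun k : ℕ => ∫ y, birkhoffSum T v (I.τ y) y * g ((I.induced T)^[k + 1] y) ∂ν :=
  .of_norm_bounded (((summable_geometric_of_lt_one hd.rate_nonneg hd.rate_lt_one).mul_left
    A).mul_right _) (H.abs_corr_le hd hg hW hgW)

lemma abs_tsum_corr_le (H : TowerData T I ν) (hd : DecayBound T I ν v A γ)
    {g : Λ → ℝ} (hg : Measurable g) (hW : 0 ≤ W) (hgW : ∀ y, |g y| ≤ W * I.τ y) :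
    |∑' k : ℕ, ∫ y, birkhoffSum T v (I.τ y) y * g ((I.induced T)^[k + 1] y) ∂ν| ≤
      A / (1 - γ) * ∫ y, |g y| ∂ν := by
  have h := tsum_of_norm_bounded (f := fun k : ℕ =>
    ∫ y, birkhoffSum T v (I.τ y) y * g ((I.induced T)^[k + 1] y) ∂ν) (((hasSum_geometric_of_lt_one hd.rate_nonneg
    hd.rate_lt_one).mul_left A).mul_right (∫ y, |g y| ∂ν)) (H.abs_corr_le hd hg hW hgW)
  rwa [← div_eq_mul_inv] at h

lemma nonneg_of_abs_le (H : TowerData T I ν) (hbW : ∀ x, |b x| ≤ W) : 0 ≤ W := by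
  have := H.isProbabilityMeasure
  obtain ⟨x0⟩ : Nonempty Λ := nonempty_of_isProbabilityMeasure ν
  exact (abs_nonneg _).trans (hbW x0)

lemma greenKubo_add (H : TowerData T I ν) (hd : DecayBound T I ν v A γ) (hv : Measurable v)
    (hV : ∀ x, |v x| ≤ V) (hb : Measurable b) (hbW : ∀ x, |b x| ≤ W) (hb' : Measurable b')
    (hbW' : ∀ x, |b' x| ≤ W') :
    greenKubo T I ν v (fun x => b x + b' x) = greenKubo T I ν v b + greenKubo T I ν v b' := by
  have hW := H.nonneg_of_abs_le hbW
  have hW' := H.nonneg_of_abs_le hbW'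
  have h1 : ∀ n y, birkhoffSum T (fun x => b x + b' x) n y =
      birkhoffSum T b n y + birkhoffSum T b' n y := fun n y => Finset.sum_add_distrib
  simp only [greenKubo, h1, mul_add, Finset.sum_add_distrib]
  rw [integral_add (H.integrable_tri hv hb hV hbW) (H.integrable_tri hv hb' hV hbW')]
  have h2 : ∀ k : ℕ, ∫ y, (birkhoffSum T v (I.τ y) y *
      birkhoffSum T b (I.τ ((I.induced T)^[k + 1] y)) ((I.induced T)^[k + 1] y) +
      birkhoffSum T v (I.τ y) y *
      birkhoffSum T b' (I.τ ((I.induced T)^[k + 1] y)) ((I.induced T)^[k + 1] y)) ∂ν = _ :=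
    fun k => integral_add
      (H.integrable_corr hv hV (H.measurable_ind hb) (abs_ind_le hbW) (k + 1))
      (H.integrable_corr hv hV (H.measurable_ind hb') (abs_ind_le hbW') (k + 1))
  simp only [h2]
  rw [Summable.tsum_add (H.summable_corr hd (H.measurable_ind hb) hW (abs_ind_le hbW))
    (H.summable_corr hd (H.measurable_ind hb') hW' (abs_ind_le hbW'))]
  ring

lemma greenKubo_sum (H : TowerData T I ν) (hd : DecayBound T I ν v A γ) (hv : Measurable v)
    (hV : ∀ x, |v x| ≤ V) {f : ℕ → Λ → ℝ} (hf : ∀ j, Measurable (f j))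
    (hfW : ∀ j x, |f j x| ≤ W) (k : ℕ) :
    greenKubo T I ν v (fun x => ∑ j ∈ Finset.range k, f j x) =
      ∑ j ∈ Finset.range k, greenKubo T I ν v (f j) := by
  induction k with
  | zero => simp [greenKubo, birkhoffSum]
  | succ k ih =>
    simp only [Finset.sum_range_succ]
    rw [H.greenKubo_add hd hv hV (Finset.measurable_fun_sum _ fun j _ => hf j)
      (W := k * W) (fun x => ?_) (hf k) (hfW k), ih]
    refine (Finset.abs_sum_le_sum_abs _ _).trans
      ((Finset.sum_le_sum fun j _ => hfW j x).trans_eq (by simp))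

/-- The identity behind the whole argument: correlations are discrete derivatives of the Green-Kubo
functional along `b ↦ b ∘ T`. -/
lemma integral_mul_comp (H : TowerData T I ν)
    (hμ : IsProbabilityMeasure (I.projectedMeasure T ν)) (hd : DecayBound T I ν v A γ)
    (hv : Measurable v) (hV : ∀ x, |v x| ≤ V) (hb : Measurable b) (hbW : ∀ x, |b x| ≤ W) :
    ∫ x, v x * b (T x) ∂(I.projectedMeasure T ν) =
      greenKubo T I ν v b - greenKubo T I ν v fun x => b (T x) := by
  have hW := H.nonneg_of_abs_le hbW
  have hV0 := H.nonneg_of_abs_le hV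
  have hbT : Measurable fun x => b (T x) := hb.comp H.measurable_T
  have hbTW : ∀ x, |b (T x)| ≤ W := fun x => hbW _
  have hbi : ∀ k, Integrable (fun y => birkhoffSum T v (I.τ y) y * b ((I.induced T)^[k] y)) ν := by
    intro k
    refine ((H.integrable_ind hv hV0 hV).abs.mul_const W).mono' ((H.measurable_ind hv).mul
      (hb.comp (H.measurable_F.iterate k))).aestronglyMeasurable (.of_forall fun y => ?_)
    rw [Real.norm_eq_abs, abs_mul]
    exact mul_le_mul_of_nonneg_left (hbW _) (abs_nonneg _)
  set a : ℕ → ℝ := fun k => ∫ y, birkhoffSum T v (I.τ y) y * b ((I.induced T)^[k + 1] y) ∂ν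
  have ha : Summable a := by
    refine .of_norm_bounded (((summable_geometric_of_lt_one hd.rate_nonneg hd.rate_lt_one).mul_left
      A).mul_right (∫ y, |b y| ∂ν)) fun k => hd.bound k b hb (H.integrable_bdd hb hbW) ?_
    refine (H.integrable_τ.mul_const W).mono' (H.measurable_τ_real.mul
      (hb.comp (H.measurable_F.iterate (k + 1)))).aestronglyMeasurable (.of_forall fun y => ?_)
    rw [Real.norm_eq_abs, abs_mul, Nat.abs_cast]
    exact mul_le_mul_of_nonneg_left (hbW _) (Nat.cast_nonneg _)
  have hcorr : ∀ k : ℕ,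
      ∫ y, birkhoffSum T v (I.τ y) y *
          birkhoffSum T b (I.τ ((I.induced T)^[k + 1] y)) ((I.induced T)^[k + 1] y) ∂ν -
        ∫ y, birkhoffSum T v (I.τ y) y * birkhoffSum T (fun x => b (T x))
          (I.τ ((I.induced T)^[k + 1] y)) ((I.induced T)^[k + 1] y) ∂ν = a k - a (k + 1) := by
    intro k
    rw [← integral_sub
      (H.integrable_corr hv hV (H.measurable_ind hb) (abs_ind_le hbW) (k + 1))
      (H.integrable_corr hv hV (H.measurable_ind hbT) (abs_ind_le hbTW) (k + 1)),
      ← integral_sub (hbi (k + 1)) (hbi (k + 2))]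
    congr 1 with y
    rw [birkhoffSum_comp_self, Function.iterate_succ_apply' (I.induced T) (k + 1)]
    simp only [InducingScheme.induced]
    ring
  -- The differences `a k - a (k + 1)` telescope, leaving `a 0`.
  have htsum := (Summable.tsum_sub
    (H.summable_corr hd (H.measurable_ind hb) hW (abs_ind_le hbW))
    (H.summable_corr hd (H.measurable_ind hbT) hW (abs_ind_le hbTW))).symm
  simp only [hcorr] at htsum
  rw [Summable.tsum_sub ha ((summable_nat_add_iff 1).2 ha), ha.tsum_eq_zero_add,
    add_sub_cancel_right] at htsum
  rw [H.integral_projected hμ (b := fun x => v x * b (T x)) (W := V * W) (hv.mul hbT) (fun x => by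
    rw [abs_mul]; exact mul_le_mul (hV x) (hbTW x) (abs_nonneg _) hV0)]
  simp only [greenKubo]
  rw [← mul_sub]
  congr 1
  -- The boundary term of the summation by parts at the top of the tower is `S_τ v · b ∘ F`, whose
  -- integral is the same `a 0`.
  have hsplit : ∫ y, birkhoffSum T (fun x => v x * b (T x)) (I.τ y) y ∂ν =
      ∫ y, ∑ l ∈ Finset.range (I.τ y), birkhoffSum T v l y * b (T^[l] y) ∂ν -
        ∫ y, ∑ l ∈ Finset.range (I.τ y), birkhoffSum T v l y * b (T (T^[l] y)) ∂ν + a 0 := by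
    have htri := (H.integrable_tri hv hb hV hbW).sub (H.integrable_tri hv hbT hV hbTW)
    simp only [Pi.sub_def] at htri
    rw [← integral_sub (H.integrable_tri hv hb hV hbW) (H.integrable_tri hv hbT hV hbTW),
      ← integral_add htri (hbi 1)]
    congr 1 with y
    exact sum_mul_eq_abel T v b (I.τ y) y
  rw [hsplit]
  linarith

/-- The correlation series is controlled by the `L¹` norm through decay. In the fibre term the extra
factor `τ` is at most `q` where `τ < q`, which again gives the `L¹` norm. Elsewhere the sup bound is
used, at the cost of the tail of `τ²`. -/
lemma abs_greenKubo_le (H : TowerData T I ν)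
    (hμ : IsProbabilityMeasure (I.projectedMeasure T ν)) (hd : DecayBound T I ν v A γ)
    (hv : Measurable v) (hV : ∀ x, |v x| ≤ V) (hb : Measurable b) (hbW : ∀ x, |b x| ≤ W)
    {q : ℝ} (hq : 0 ≤ q) :
    |greenKubo T I ν v b| ≤ (A / (1 - γ) + V * q) * ∫ x, |b x| ∂(I.projectedMeasure T ν) +
      V * W * ∫ y, {y | q ≤ I.τ y}.indicator (fun y => (I.τ y : ℝ) ^ 2) y ∂ν := by
  have hW := H.nonneg_of_abs_le hbW
  have hV0 := H.nonneg_of_abs_le hV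
  have htb := H.one_le_integral_τ
  have habs : ∀ x, |(|b x|)| ≤ W := fun x => (abs_abs (b x)).trans_le (hbW x)
  have hproj := H.integral_projected hμ hb.abs habs
  set tb := ∫ y, (I.τ y : ℝ) ∂ν
  have htb0 : 0 < tb := one_pos.trans_le htb
  have hBi := H.integrable_ind hb.abs hW habs
  have hms : MeasurableSet {y | q ≤ I.τ y} := measurableSet_le measurable_const H.measurable_τ_real
  have hind : Integrable ({y | q ≤ I.τ y}.indicator fun y => (I.τ y : ℝ) ^ 2) ν :=
    H.integrable_sq.indicator hms
  have h1 : |∑' k : ℕ, ∫ y, birkhoffSum T v (I.τ y) y *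
        birkhoffSum T b (I.τ ((I.induced T)^[k + 1] y)) ((I.induced T)^[k + 1] y) ∂ν| ≤
      A / (1 - γ) * ∫ y, birkhoffSum T (fun x => |b x|) (I.τ y) y ∂ν := by
    refine (H.abs_tsum_corr_le hd (H.measurable_ind hb) hW (abs_ind_le hbW)).trans ?_
    refine mul_le_mul_of_nonneg_left ?_ (div_nonneg hd.nonneg (sub_nonneg.2 hd.rate_lt_one.le))
    exact integral_mono (H.integrable_ind hb hW hbW).abs hBi
      fun y => Finset.abs_sum_le_sum_abs _ _
  have h2 : |∫ y, ∑ l ∈ Finset.range (I.τ y), birkhoffSum T v l y * b (T^[l] y) ∂ν| ≤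
      V * q * ∫ y, birkhoffSum T (fun x => |b x|) (I.τ y) y ∂ν +
        V * W * ∫ y, {y | q ≤ I.τ y}.indicator (fun y => (I.τ y : ℝ) ^ 2) y ∂ν := by
    rw [← integral_const_mul, ← integral_const_mul, ← integral_add (hBi.const_mul _)
      (hind.const_mul _)]
    refine abs_integral_le_integral_abs.trans (integral_mono (H.integrable_tri hv hb hV hbW).abs
      ((hBi.const_mul _).add (hind.const_mul _)) fun y => (abs_tri_le hV y).trans ?_)
    have hB0 : 0 ≤ birkhoffSum T (fun x => |b x|) (I.τ y) y :=
      Finset.sum_nonneg fun l _ => abs_nonneg _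
    rw [mul_assoc, mul_assoc, ← mul_add]
    refine mul_le_mul_of_nonneg_left ?_ hV0
    rcases le_or_gt q (I.τ y) with hy | hy
    · rw [indicator_of_mem (show y ∈ {y | q ≤ I.τ y} from hy)]
      have := (le_abs_self _).trans (abs_ind_le (T := T) (I := I) habs y)
      calc _ ≤ (I.τ y : ℝ) * (W * I.τ y) := by gcongr
        _ = W * (I.τ y : ℝ) ^ 2 := by ring
        _ ≤ _ := le_add_of_nonneg_left (by positivity)
    · rw [indicator_of_notMem (show y ∉ {y | q ≤ I.τ y} from not_le.2 hy), mul_zero, add_zero]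
      gcongr
  have hX : ∫ y, birkhoffSum T (fun x => |b x|) (I.τ y) y ∂ν =
      tb * ∫ x, |b x| ∂(I.projectedMeasure T ν) := by
    rw [hproj, mul_inv_cancel_left₀ htb0.ne']
  have hZ : 0 ≤ ∫ y, {y | q ≤ I.τ y}.indicator (fun y => (I.τ y : ℝ) ^ 2) y ∂ν :=
    integral_nonneg fun y => indicator_nonneg (fun y _ => by positivity) y
  rw [hX] at h1 h2
  rw [greenKubo, abs_mul, abs_of_pos (inv_pos.2 htb0), inv_mul_le_iff₀ htb0]
  refine (abs_add_le _ _).trans ((add_le_add h1 h2).trans ?_)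
  nlinarith [mul_nonneg (mul_nonneg hV0 hW) hZ]

/-- The summed correlations in terms of the Green-Kubo functional. -/
lemma sum_integral_eq (H : TowerData T I ν)
    (hμ : IsProbabilityMeasure (I.projectedMeasure T ν)) (hd : DecayBound T I ν v A γ)
    (hv : Measurable v) (hV : ∀ x, |v x| ≤ V) (hb : Measurable b) (hbW : ∀ x, |b x| ≤ W) (k : ℕ) :
    ∑ j ∈ Finset.range k, ∑ i ∈ Finset.range j,
        ∫ x, v (T^[i] x) * b (T^[j] x) ∂(I.projectedMeasure T ν) =
      k * greenKubo T I ν v b - greenKubo T I ν v (birkhoffSum T b k) := by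
  have hV0 := H.nonneg_of_abs_le hV
  have hbm : ∀ j, Measurable fun x => b (T^[j] x) := fun j => hb.comp (H.measurable_T.iterate j)
  have h1 : ∀ j, ∑ i ∈ Finset.range j, ∫ x, v (T^[i] x) * b (T^[j] x) ∂(I.projectedMeasure T ν) =
      greenKubo T I ν v b - greenKubo T I ν v fun x => b (T^[j] x) := by
    intro j
    -- Invariance shifts `T^i` away, leaving the correlation at lag `j - i`, and the coboundary
    -- identity turns it into an increment of a telescoping sum.
    have h2 : ∀ i ∈ Finset.range j, ∫ x, v (T^[i] x) * b (T^[j] x) ∂(I.projectedMeasure T ν) =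
        (fun i => greenKubo T I ν v fun x => b (T^[j - i] x)) (i + 1) -
          (fun i => greenKubo T I ν v fun x => b (T^[j - i] x)) i := by
      intro i hi
      obtain ⟨n, rfl⟩ : ∃ n, j = i + (n + 1) :=
        Nat.exists_eq_add_of_le (Nat.succ_le_of_lt (Finset.mem_range.1 hi)) |>.imp fun n hn => by
          omega
      have h3 := H.integral_comp_iterate hμ (b := fun x => v x * b (T^[n + 1] x)) (W := V * W)
        (hv.mul (hbm _)) (fun x => by
          rw [abs_mul]; exact mul_le_mul (hV x) (hbW _) (abs_nonneg _) hV0) i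
      have h4 := H.integral_mul_comp hμ hd hv hV (hbm n) fun x => hbW _
      simp only [← Function.iterate_succ_apply] at h4
      simp only [← Function.iterate_add_apply, add_comm _ i] at h3
      rw [h3, h4]
      simp [show i + (n + 1) - (i + 1) = n by omega, show i + (n + 1) - i = n + 1 by omega]
    exact (Finset.sum_congr rfl h2).trans ((Finset.sum_range_sub
      (fun i => greenKubo T I ν v fun x => b (T^[j - i] x)) j).trans (by simp))
  simp only [h1]
  rw [Finset.sum_sub_distrib]
  congr 1
  · simp
  · exact (H.greenKubo_sum hd hv hV hbm (fun j x => hbW _) k).symm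

end TowerData

/-! ### Uniform convergence of the averages -/

lemma sum_mul_sum_eq (a b : ℕ → ℝ) (k : ℕ) :
    (∑ i ∈ Finset.range k, a i) * ∑ j ∈ Finset.range k, b j =
      ∑ j ∈ Finset.range k, a j * b j +
        ∑ j ∈ Finset.range k, ∑ i ∈ Finset.range j, a i * b j +
          ∑ j ∈ Finset.range k, ∑ i ∈ Finset.range j, b i * a j := by
  induction k with
  | zero => simp
  | succ k ih =>
    simp only [Finset.sum_range_succ, ← Finset.sum_mul] at ih ⊢
    linear_combination ih

namespace TowerData

variable {Λ : Type*} [MeasurableSpace Λ] {T : Λ → Λ} {I : InducingScheme Λ} {ν : Measure Λ}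
  {v w b : Λ → ℝ} {V W A γ M q : ℝ}

lemma integrable_corr_iterate {μ : Measure Λ} [IsFiniteMeasure μ] (hT : Measurable T)
    (hv : Measurable v) (hV : ∀ x, |v x| ≤ V) (hb : Measurable b) (hbW : ∀ x, |b x| ≤ W)
    (i j : ℕ) : Integrable (fun x => v (T^[i] x) * b (T^[j] x)) μ :=
  (integrable_const (V * W)).mono'
    ((hv.comp (hT.iterate i)).mul (hb.comp (hT.iterate j))).aestronglyMeasurable
    (.of_forall fun x => by
      rw [Real.norm_eq_abs, abs_mul]
      exact mul_le_mul (hV _) (hbW _) (abs_nonneg _) ((abs_nonneg _).trans (hV x)))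

lemma integral_mul_birkhoffSum {μ : Measure Λ} [IsFiniteMeasure μ] (hT : Measurable T)
    (hv : Measurable v) (hV : ∀ x, |v x| ≤ V) (hb : Measurable b) (hbW : ∀ x, |b x| ≤ W) (k : ℕ) :
    ∫ x, birkhoffSum T v k x * birkhoffSum T b k x ∂μ =
      ∑ j ∈ Finset.range k, ∫ x, v (T^[j] x) * b (T^[j] x) ∂μ +
        ∑ j ∈ Finset.range k, ∑ i ∈ Finset.range j, ∫ x, v (T^[i] x) * b (T^[j] x) ∂μ +
          ∑ j ∈ Finset.range k, ∑ i ∈ Finset.range j, ∫ x, b (T^[i] x) * v (T^[j] x) ∂μ := by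
  have h1 := fun i j => integrable_corr_iterate (μ := μ) hT hv hV hb hbW i j
  have h2 := fun i j => integrable_corr_iterate (μ := μ) hT hb hbW hv hV i j
  simp only [birkhoffSum, sum_mul_sum_eq]
  have i1 := integrable_finsetSum (Finset.range k) fun j _ => h1 j j
  have i2 := integrable_finsetSum (Finset.range k) fun j _ =>
    integrable_finsetSum (Finset.range j) fun i _ => h1 i j
  have i3 := integrable_finsetSum (Finset.range k) fun j _ =>
    integrable_finsetSum (Finset.range j) fun i _ => h2 i j
  have i12 := i1.add i2
  simp only [Pi.add_def] at i12
  rw [integral_add i12 i3, integral_add i1 i2,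
    integral_finsetSum _ fun j _ => h1 j j, integral_finsetSum _ fun j _ =>
      integrable_finsetSum (Finset.range j) fun i _ => h1 i j, integral_finsetSum _ fun j _ =>
      integrable_finsetSum (Finset.range j) fun i _ => h2 i j]
  simp only [integral_finsetSum _ fun i _ => h1 i _, integral_finsetSum _ fun i _ => h2 i _]

/-- The summed-correlation identity with `v = b` bounds the second moment of `S_k b` by a multiple
of `k`. Only the crude sup-norm estimate of the functional is needed here. -/
lemma integral_abs_birkhoffSum_le (H : TowerData T I ν)
    (hμ : IsProbabilityMeasure (I.projectedMeasure T ν)) (hd : DecayBound T I ν b A γ)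
    (hb : Measurable b) (hbW : ∀ x, |b x| ≤ W) (hM : ∫ y, (I.τ y : ℝ) ^ 2 ∂ν ≤ M) (k : ℕ) :
    ∫ x, |birkhoffSum T b k x| ∂(I.projectedMeasure T ν) ≤
      (1 + W ^ 2 + 4 * (A / (1 - γ) * W + W ^ 2 * M)) / 2 * √k := by
  set μ := I.projectedMeasure T ν
  have hW := H.nonneg_of_abs_le hbW
  rcases Nat.eq_zero_or_pos k with rfl | hk
  · simp [birkhoffSum]
  have hk' : (0 : ℝ) < k := by exact_mod_cast hk
  set C := A / (1 - γ) * W + W ^ 2 * M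
  have hA : 0 ≤ A / (1 - γ) := div_nonneg hd.nonneg (sub_nonneg.2 hd.rate_lt_one.le)
  -- Take the cutoff `q = 0`, so that the tail is the whole second moment of `τ`. This is used with
  -- `c = 1` for `b` and `c = k` for `S_k b`.
  have hD : ∀ (f : Λ → ℝ) (c : ℝ), Measurable f → (∀ x, |f x| ≤ c * W) → 0 ≤ c →
      |greenKubo T I ν b f| ≤ c * C := by
    intro f c hf hfc hc
    refine (H.abs_greenKubo_le hμ hd hb hbW hf hfc le_rfl).trans ?_
    have h1 : ∫ x, |f x| ∂μ ≤ c * W := by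
      refine (integral_mono_of_nonneg (.of_forall fun x => abs_nonneg _)
        (integrable_const (c * W)) (.of_forall hfc)).trans_eq (by simp)
    have h2 : ∫ y, {y | (0 : ℝ) ≤ I.τ y}.indicator (fun y => (I.τ y : ℝ) ^ 2) y ∂ν ≤ M := by
      refine le_of_eq_of_le (integral_congr_ae (.of_forall fun y => ?_)) hM
      simp
    calc _ ≤ (A / (1 - γ) + W * 0) * (c * W) + W * (c * W) * M := by gcongr
      _ = _ := by ring
  have hSm : Measurable (birkhoffSum T b k) := measurable_birkhoffSum H.measurable_T hb k
  have hSb : ∀ x, |birkhoffSum T b k x| ≤ k * W := abs_birkhoffSum_le hbW k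
  have hsq : ∫ x, birkhoffSum T b k x * birkhoffSum T b k x ∂μ ≤ k * (W ^ 2 + 4 * C) := by
    rw [integral_mul_birkhoffSum H.measurable_T hb hbW hb hbW,
      H.sum_integral_eq hμ hd hb hbW hb hbW]
    have h1 : ∑ j ∈ Finset.range k, ∫ x, b (T^[j] x) * b (T^[j] x) ∂μ ≤ k * W ^ 2 := by
      refine (Finset.sum_le_sum fun j _ => ?_).trans_eq (b := ∑ _j ∈ Finset.range k, W ^ 2)
        (by simp)
      refine (integral_mono_of_nonneg (.of_forall fun x => mul_self_nonneg _)
        (integrable_const (W ^ 2)) (.of_forall fun x => ?_)).trans_eq (by simp)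
      rw [← abs_mul_abs_self, sq]
      exact mul_self_le_mul_self (abs_nonneg _) (hbW _)
    have h2 := abs_le.1 (hD b 1 hb (by simpa using hbW) zero_le_one)
    have h3 := abs_le.1 (hD _ k hSm hSb hk'.le)
    nlinarith [mul_le_mul_of_nonneg_left h2.2 hk'.le]
  have hs : 0 < √(k : ℝ) := Real.sqrt_pos.2 hk'
  have hss : √(k : ℝ) * √(k : ℝ) = k := Real.mul_self_sqrt hk'.le
  have hSi : Integrable (fun x => birkhoffSum T b k x * birkhoffSum T b k x) μ :=
    (integrable_const (k * W * (k * W))).mono' (hSm.mul hSm).aestronglyMeasurable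
      (.of_forall fun x => by
        rw [Real.norm_eq_abs, abs_mul]
        exact mul_self_le_mul_self (abs_nonneg _) (hSb x))
  -- Pointwise `|S| ≤ √k / 2 + S² / (2 √k)`, in place of Cauchy-Schwarz.
  calc ∫ x, |birkhoffSum T b k x| ∂μ
      ≤ ∫ x, (√k / 2 + (2 * √k)⁻¹ * (birkhoffSum T b k x * birkhoffSum T b k x)) ∂μ := by
        refine integral_mono_of_nonneg (.of_forall fun x => abs_nonneg _)
          ((integrable_const _).add (hSi.const_mul _)) (.of_forall fun x => ?_)
        simp only
        rw [← abs_mul_abs_self (birkhoffSum T b k x), inv_mul_eq_div, div_add_div _ _ two_ne_zero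
          (by positivity), le_div_iff₀ (by positivity)]
        nlinarith [sq_nonneg (√k - |birkhoffSum T b k x|)]
    _ = √k / 2 + (2 * √k)⁻¹ * ∫ x, birkhoffSum T b k x * birkhoffSum T b k x ∂μ := by
        rw [integral_add (integrable_const _) (hSi.const_mul _), integral_const_mul]
        simp
    _ ≤ √k / 2 + (2 * √k)⁻¹ * (k * (W ^ 2 + 4 * C)) := by gcongr
    _ = (1 + W ^ 2 + 4 * C) / 2 * √k := by
        nth_rw 3 [← hss]
        field_simp
        ring

/-- The difference is exactly `-greenKubo v (S_k b) / k`. The cutoff `q` stays free, to be chosen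
before `k`. -/
lemma abs_average_sub_le (H : TowerData T I ν)
    (hμ : IsProbabilityMeasure (I.projectedMeasure T ν)) (hdv : DecayBound T I ν v A γ)
    (hdb : DecayBound T I ν b A γ) (hv : Measurable v) (hV : ∀ x, |v x| ≤ V)
    (hb : Measurable b) (hbV : ∀ x, |b x| ≤ V) (hM : ∫ y, (I.τ y : ℝ) ^ 2 ∂ν ≤ M) (hq : 0 ≤ q)
    {k : ℕ} (hk : 0 < k) :
    |(k : ℝ)⁻¹ * ∑ j ∈ Finset.range k, ∑ i ∈ Finset.range j,
        ∫ x, v (T^[i] x) * b (T^[j] x) ∂(I.projectedMeasure T ν) - greenKubo T I ν v b| ≤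
      (A / (1 - γ) + V * q) * ((1 + V ^ 2 + 4 * (A / (1 - γ) * V + V ^ 2 * M)) / 2) / √k +
      V ^ 2 * ∫ y, {y | q ≤ I.τ y}.indicator (fun y => (I.τ y : ℝ) ^ 2) y ∂ν := by
  have hV0 := H.nonneg_of_abs_le hV
  have hA : 0 ≤ A / (1 - γ) := div_nonneg hdv.nonneg (sub_nonneg.2 hdv.rate_lt_one.le)
  have hk' : (0 : ℝ) < k := by exact_mod_cast hk
  have hs : 0 < √(k : ℝ) := Real.sqrt_pos.2 hk'
  have hss : √(k : ℝ) * √(k : ℝ) = k := Real.mul_self_sqrt hk'.le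
  rw [H.sum_integral_eq hμ hdv hv hV hb hbV, mul_sub, inv_mul_cancel_left₀ hk'.ne', sub_sub_cancel_left,
    abs_neg, abs_mul, abs_of_pos (inv_pos.2 hk'), inv_mul_le_iff₀ hk']
  refine (H.abs_greenKubo_le hμ hdv hv hV (measurable_birkhoffSum H.measurable_T hb k)
    (abs_birkhoffSum_le hbV k) hq).trans ?_
  have h1 := H.integral_abs_birkhoffSum_le hμ hdb hb hbV hM k
  set X := (1 + V ^ 2 + 4 * (A / (1 - γ) * V + V ^ 2 * M)) / 2
  refine (add_le_add_left (mul_le_mul_of_nonneg_left h1 (by positivity)) _).trans_eq ?_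
  nth_rw 3 [← hss]
  field_simp
  linear_combination -(V ^ 2 * ∫ y, {y | q ≤ I.τ y}.indicator (fun y => (I.τ y : ℝ) ^ 2) y ∂ν) * hss

end TowerData

/-! ### Moments and rates uniform over the family. -/

section Family

variable {Λ : Type*} [MetricSpace Λ] [MeasurableSpace Λ] {ρ : Measure Λ} {η : ℝ≥0}

lemma towerData {T : Λ → Λ} {I : InducingScheme Λ} {ν : Measure Λ} {β C₁ : ℝ}
    (hT : IsNonuniformlyExpanding ρ T I β C₁ η) (hν : IsInducedMeasure ρ T I ν)
    (hτ : Integrable (fun y => (I.τ y : ℝ) ^ 2) ν) : TowerData T I ν where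
  measurable_T := hT.nonsingular.measurable
  measurableSet_Y := hT.measurableSet_Y
  measurable_τ := hT.measurable_τ
  isProbabilityMeasure := hν.isProbabilityMeasure
  ae_mem := hν.absolutelyContinuous.ae_le (ae_restrict_mem hT.measurableSet_Y)
  ae_one_le := hν.absolutelyContinuous.ae_le
    ((ae_restrict_mem hT.measurableSet_Y).mono hT.one_le_τ)
  invariant := hν.invariant
  integrable_sq := hτ

variable {ι : Type*} {T : ι → Λ → Λ} {I : ι → InducingScheme Λ} {μY μ : ι → Measure Λ} {p : ℝ}

lemma IsUniformFamily.exists_tail (hT : IsUniformFamily ρ T I μY μ η p) (hp : 2 < p) {ε : ℝ}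
    (hε : 0 < ε) : ∃ q : ℝ, 0 ≤ q ∧ ∀ n,
      ∫⁻ y in {y | q ≤ ((I n).τ y : ℝ)}, ENNReal.ofReal ((I n).τ y ^ 2 : ℝ) ∂(μY n) ≤
        ENNReal.ofReal ε := by
  obtain ⟨q, hq, hq1⟩ := ((hT.uniformIntegrable.eventually_le_const
    (ENNReal.ofReal_pos.2 hε)).and (eventually_ge_atTop 1)).exists
  refine ⟨q, zero_le_one.trans hq1, fun n => le_trans ?_ ((le_iSup _ n).trans hq)⟩
  obtain ⟨β, C₁, hE⟩ := hT.expanding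
  have hm : MeasurableSet {y | q ≤ ((I n).τ y : ℝ)} :=
    measurableSet_le measurable_const (measurable_from_nat.comp (hE n).measurable_τ)
  refine setLIntegral_mono' hm fun y hy => ?_
  have h1 : (1 : ℝ≥0∞) ≤ (I n).τ y := by
    have : (1 : ℝ) ≤ (I n).τ y := hq1.trans hy
    exact_mod_cast this
  rw [ENNReal.ofReal_pow (Nat.cast_nonneg _), ENNReal.ofReal_natCast, ← ENNReal.rpow_natCast]
  exact ENNReal.rpow_le_rpow_of_exponent_le h1 (by exact_mod_cast hp.le)

lemma IsUniformFamily.exists_second_moment (hT : IsUniformFamily ρ T I μY μ η p) (hp : 2 < p) :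
    ∃ M : ℝ, 0 ≤ M ∧ ∀ n, Integrable (fun y => ((I n).τ y : ℝ) ^ 2) (μY n) ∧
      ∫ y, ((I n).τ y : ℝ) ^ 2 ∂(μY n) ≤ M := by
  obtain ⟨q, hq0, hq⟩ := hT.exists_tail hp one_pos
  obtain ⟨β, C₁, hE⟩ := hT.expanding
  refine ⟨q ^ 2 + 1, by positivity, fun n => ?_⟩
  have := (hT.inducedMeasure n).isProbabilityMeasure
  have hτm : Measurable fun y => ((I n).τ y : ℝ) := measurable_from_nat.comp (hE n).measurable_τ
  have hm : MeasurableSet {y | q ≤ ((I n).τ y : ℝ)} := measurableSet_le measurable_const hτm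
  have hle : ∫⁻ y, ENNReal.ofReal ((I n).τ y ^ 2 : ℝ) ∂(μY n) ≤ ENNReal.ofReal (q ^ 2 + 1) := by
    rw [← lintegral_add_compl _ hm, add_comm, ENNReal.ofReal_add (by positivity) zero_le_one]
    refine add_le_add ?_ (hq n)
    calc _ ≤ ∫⁻ y in {y | q ≤ ((I n).τ y : ℝ)}ᶜ, ENNReal.ofReal (q ^ 2) ∂(μY n) := by
          refine setLIntegral_mono' hm.compl fun y hy => ENNReal.ofReal_le_ofReal ?_
          gcongr
          exact (not_le.1 (show ¬q ≤ ((I n).τ y : ℝ) from hy)).le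
      _ ≤ ENNReal.ofReal (q ^ 2) * 1 := by
          rw [setLIntegral_const]
          gcongr
          exact prob_le_one
      _ = _ := mul_one _
  have hi : Integrable (fun y => ((I n).τ y : ℝ) ^ 2) (μY n) :=
    ⟨(hτm.pow_const 2).aestronglyMeasurable, by
      rw [hasFiniteIntegral_iff_ofReal (.of_forall fun y => by positivity)]
      exact hle.trans_lt ENNReal.ofReal_lt_top⟩
  refine ⟨hi, ?_⟩
  rw [← ofReal_integral_eq_lintegral_ofReal hi (.of_forall fun y => by positivity)] at hle
  exact (ENNReal.ofReal_le_ofReal_iff (by positivity)).1 hle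

/-- The averages of the iterated sums converge uniformly in the family. -/
lemma IsUniformFamily.exists_uniform_rate [BoundedSpace Λ] [BorelSpace Λ] [IsFiniteMeasure ρ]
    [Nonempty ι] (hT : IsUniformFamily ρ T I μY μ η p) (hp : 2 < p)
    (hμ : ∀ n, IsProbabilityMeasure (μ n)) {V ε : ℝ} (hV : 0 < V) (hε : 0 < ε) :
    ∃ k₀ : ℕ, ∀ k ≥ k₀, ∀ n (v w : Λ → ℝ), HolderBound η V v → HolderBound η V w →
      ∫ x, v x ∂(μ n) = 0 → ∫ x, w x ∂(μ n) = 0 →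
      |(k : ℝ)⁻¹ * ∑ j ∈ Finset.range k, ∑ i ∈ Finset.range j,
        ∫ x, v ((T n)^[i] x) * w ((T n)^[j] x) ∂(μ n) - greenKubo (T n) (I n) (μY n) v w| ≤ ε := by
  obtain ⟨β, C₁, hE⟩ := hT.expanding
  have hE0 := hE (Classical.arbitrary ι)
  obtain ⟨K, γ, hK, hγ0, hγ1, hdec⟩ := exists_decay Λ hE0.one_lt_β hE0.one_le_C₁ hE0.η_pos
  obtain ⟨M, hM0, hM⟩ := hT.exists_second_moment hp
  -- The cutoff makes the tail term at most `ε / 2` for every `n`. The constant `A` below is uniform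
  -- because `τ ≤ τ²` bounds the mean return time by `M`.
  obtain ⟨q, hq0, hq⟩ := hT.exists_tail hp (show 0 < ε / (2 * V ^ 2) by positivity)
  set A := K * V * M
  set X := (A / (1 - γ) + V * q) * ((1 + V ^ 2 + 4 * (A / (1 - γ) * V + V ^ 2 * M)) / 2)
  have hlim : Tendsto (fun k : ℕ => X / √k) atTop (𝓝 0) :=
    Tendsto.div_atTop tendsto_const_nhds (Real.tendsto_sqrt_atTop.comp tendsto_natCast_atTop_atTop)
  obtain ⟨k₀, hk₀⟩ := eventually_atTop.1
    ((hlim.eventually_le_const (half_pos hε)).and (eventually_gt_atTop 0))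
  refine ⟨k₀, fun k hk n v w hv hw hv0 hw0 => ?_⟩
  have H := towerData (hE n) (hT.inducedMeasure n) (hM n).1
  have hμn := hμ n
  rw [hT.measure_eq n] at hμn hv0 hw0 ⊢
  have htb : ∫ y, ((I n).τ y : ℝ) ∂(μY n) ≤ M :=
    (integral_mono H.integrable_τ (hM n).1 fun y => by
      have := Nat.le_self_pow two_ne_zero ((I n).τ y)
      show ((I n).τ y : ℝ) ≤ ((I n).τ y : ℝ) ^ 2
      exact_mod_cast this).trans (hM n).2
  have hdb : ∀ f : Λ → ℝ, HolderBound η V f →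
      ∫ x, f x ∂((I n).projectedMeasure (T n) (μY n)) = 0 →
      DecayBound (T n) (I n) (μY n) f A γ := by
    intro f hf hf0
    have hfm := (hf.continuous hE0.η_pos).measurable
    rw [H.integral_projected hμn hfm hf.abs_le] at hf0
    have hf0' := (mul_eq_zero.1 hf0).resolve_left
      (inv_ne_zero (one_pos.trans_le H.one_le_integral_τ).ne')
    refine ⟨by positivity, hγ0, hγ1, fun k g hg hgi hτg => ?_⟩
    refine (hdec ρ (T n) (I n) (μY n) (hE n) (hT.inducedMeasure n) H.integrable_τ V f hf hf0' k g
      hg hgi hτg).trans ?_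
    calc _ ≤ K * γ ^ k * V * M * ∫ y, |g y| ∂(μY n) := by
          have : 0 ≤ ∫ y, |g y| ∂(μY n) := integral_nonneg fun y => abs_nonneg _
          gcongr
      _ = _ := by ring
  have hvm := (hv.continuous hE0.η_pos).measurable
  have hwm := (hw.continuous hE0.η_pos).measurable
  refine (H.abs_average_sub_le hμn (hdb v hv hv0) (hdb w hw hw0) hvm hv.abs_le hwm hw.abs_le
    (hM n).2 hq0 (hk₀ k hk).2).trans ?_
  have hms : MeasurableSet {y | q ≤ ((I n).τ y : ℝ)} :=
    measurableSet_le measurable_const H.measurable_τ_real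
  have htail : ∫ y, {y | q ≤ ((I n).τ y : ℝ)}.indicator (fun y => ((I n).τ y : ℝ) ^ 2) y ∂(μY n) ≤
      ε / (2 * V ^ 2) := by
    rw [integral_indicator hms]
    have := hq n
    rwa [← ofReal_integral_eq_lintegral_ofReal (hM n).1.integrableOn
      (.of_forall fun y => by positivity), ENNReal.ofReal_le_ofReal_iff (by positivity)] at this
  calc _ ≤ ε / 2 + V ^ 2 * (ε / (2 * V ^ 2)) :=
        add_le_add (hk₀ k hk).1 (mul_le_mul_of_nonneg_left htail (by positivity))
    _ = ε := by field_simp; ring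

end Family

/-! ### Components of Hölder observables -/

section Components

variable {Λ : Type*} [MetricSpace Λ] {η : ℝ≥0} {V V' : ℝ}

lemma HolderBound.mono {f : Λ → ℝ} (hf : HolderBound η V f) (h : V ≤ V') : HolderBound η V' f where
  pos := hf.pos.trans_le h
  abs_le x := (hf.abs_le x).trans h
  abs_sub_le x y := (hf.abs_sub_le x y).trans (by gcongr)

lemma HolderBound.add {f g : Λ → ℝ} (hf : HolderBound η V f) (hg : HolderBound η V' g) :
    HolderBound η (V + V') (fun x => f x + g x) where
  pos := add_pos hf.pos hg.pos
  abs_le x := (abs_add_le _ _).trans (add_le_add (hf.abs_le x) (hg.abs_le x))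
  abs_sub_le x y := by
    rw [add_sub_add_comm, add_mul]
    exact (abs_add_le _ _).trans (add_le_add (hf.abs_sub_le x y) (hg.abs_sub_le x y))

lemma HolderBound.isHolder {f : Λ → ℝ} (hf : HolderBound η V f) : IsHolder η f := by
  refine ENNReal.add_lt_top.2 ⟨?_, eHolderNorm_lt_top.2 ⟨_, hf.holderWith⟩⟩
  refine (iSup_le fun x => ?_ : _ ≤ ENNReal.ofReal V).trans_lt ENNReal.ofReal_lt_top
  rw [← ofReal_norm]
  exact ENNReal.ofReal_le_ofReal (hf.abs_le x)

lemma holderBound_component {d : ℕ} {v : Λ → EuclideanSpace ℝ (Fin d)} (hV : 0 < V)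
    (hv : holderNorm η v ≤ ENNReal.ofReal V) (r : Fin d) : HolderBound η V fun x => v x r where
  pos := hV
  abs_le x := by
    have h1 : ENNReal.ofReal ‖v x‖ ≤ ENNReal.ofReal V := by
      rw [ofReal_norm]
      exact (le_iSup (fun x => ‖v x‖ₑ) x).trans (le_self_add.trans hv)
    exact (PiLp.norm_apply_le (v x) r).trans ((ENNReal.ofReal_le_ofReal_iff hV.le).1 h1)
  abs_sub_le x y := by
    have h1 : eHolderNorm η v ≤ ENNReal.ofReal V := le_add_self.trans hv
    have hm : MemHolder η v := eHolderNorm_lt_top.1 (h1.trans_lt ENNReal.ofReal_lt_top)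
    have h2 : (nnHolderNorm η v : ℝ) ≤ V := by
      rw [← hm.coe_nnHolderNorm_eq_eHolderNorm, ← ENNReal.ofReal_coe_nnreal,
        ENNReal.ofReal_le_ofReal_iff hV.le] at h1
      exact h1
    calc |v x r - v y r| = ‖(v x - v y) r‖ := by simp
      _ ≤ ‖v x - v y‖ := PiLp.norm_apply_le _ r
      _ = dist (v x) (v y) := (dist_eq_norm _ _).symm
      _ ≤ nnHolderNorm η v * dist x y ^ (η : ℝ) := hm.holderWith.dist_le x y
      _ ≤ V * dist x y ^ (η : ℝ) := by gcongr

lemma exists_holderBound {d : ℕ} {v : Λ → EuclideanSpace ℝ (Fin d)} (hv : IsHolder η v) :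
    ∃ V : ℝ, ∀ r, HolderBound η V fun x => v x r := by
  refine ⟨(holderNorm η v).toReal + 1, fun r => holderBound_component (by positivity) ?_ r⟩
  rw [ENNReal.ofReal_add ENNReal.toReal_nonneg zero_le_one, ENNReal.ofReal_toReal (ne_of_lt hv)]
  exact le_self_add

omit [MetricSpace Λ] in
lemma birkhoffSum_component {d : ℕ} (T : Λ → Λ) (v : Λ → EuclideanSpace ℝ (Fin d)) (k : ℕ) (x : Λ)
    (r : Fin d) : birkhoffSum T v k x r = birkhoffSum T (fun x => v x r) k x := by
  simp [birkhoffSum]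

variable [MeasurableSpace Λ] [BorelSpace Λ] {μ : Measure Λ} [IsFiniteMeasure μ] {T : Λ → Λ} {d : ℕ}
  {v : Λ → EuclideanSpace ℝ (Fin d)}

lemma integral_component (hη : 0 < η) (hv : ∀ r, HolderBound η V fun x => v x r) (r : Fin d) :
    ∫ x, v x r ∂μ = (∫ x, v x ∂μ) r :=
  (eval_integral_piLp (fun r => (integrable_const V).mono'
    ((hv r).continuous hη).measurable.aestronglyMeasurable (.of_forall (hv r).abs_le)) r).symm

lemma meanIterated_apply (hη : 0 < η) (hT : Measurable T)
    (hv : ∀ r, HolderBound η V fun x => v x r) (k : ℕ) (r s : Fin d) :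
    meanIterated μ T v k r s = (k : ℝ)⁻¹ * ∑ j ∈ Finset.range k, ∑ i ∈ Finset.range j,
      ∫ x, v (T^[i] x) r * v (T^[j] x) s ∂μ := by
  have hi : ∀ i j, Integrable (fun x => v (T^[i] x) r * v (T^[j] x) s) μ := fun i j =>
    TowerData.integrable_corr_iterate hT ((hv r).continuous hη).measurable (hv r).abs_le
      ((hv s).continuous hη).measurable (hv s).abs_le i j
  have h1 : ∀ x, iteratedSum T v k x r s = ∑ j ∈ Finset.range k, ∑ i ∈ Finset.range j,
      v (T^[i] x) r * v (T^[j] x) s := fun x => by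
    simp [iteratedSum, Matrix.sum_apply, outer]
  simp only [meanIterated, matrixIntegral, Matrix.smul_apply, Matrix.of_apply, smul_eq_mul, h1]
  rw [integral_finsetSum _ fun j _ => integrable_finsetSum (Finset.range j) fun i _ => hi i j]
  simp only [integral_finsetSum _ fun i _ => hi i _]

lemma meanSquare_apply (hη : 0 < η) (hT : Measurable T)
    (hv : ∀ r, HolderBound η V fun x => v x r) (k : ℕ) (r s : Fin d) :
    meanSquare μ T v k r s =
      (k : ℝ)⁻¹ * ∑ j ∈ Finset.range k, ∫ x, v (T^[j] x) r * v (T^[j] x) s ∂μ +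
        meanIterated μ T v k r s + meanIterated μ T v k s r := by
  rw [meanIterated_apply hη hT hv, meanIterated_apply hη hT hv, ← mul_add, ← mul_add,
    ← TowerData.integral_mul_birkhoffSum hT ((hv r).continuous hη).measurable (hv r).abs_le
      ((hv s).continuous hη).measurable (hv s).abs_le]
  simp only [meanSquare, matrixIntegral, Matrix.smul_apply, Matrix.of_apply, smul_eq_mul, outer,
    birkhoffSum_component]

end Components

/-! ### Limits along the family -/

section Limits

variable {Λ : Type*} [MetricSpace Λ] [MeasurableSpace Λ] [BorelSpace Λ] {η : ℝ≥0} {V : ℝ}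

/-- Convergence in probability of the maps, with respect to the varying measures, becomes `L¹`
convergence for bounded Hölder observables. -/
lemma tendsto_integral_abs_sub (hη : 0 < η) {μ : ℕ → Measure Λ}
    (hμ : ∀ n, IsProbabilityMeasure (μ n)) {S : ℕ → Λ → Λ} {S' : Λ → Λ}
    (hS : ∀ n, Measurable (S n)) (hS' : Measurable S')
    (hprob : ∀ a : ℝ, 0 < a →
      Tendsto (fun n => μ n {y | a < dist (S n y) (S' y)}) atTop (𝓝 0))
    {f : ℕ → Λ → ℝ} {g : Λ → ℝ} (hg : HolderBound η V g)
    (hfg : ∀ δ : ℝ, 0 < δ → ∀ᶠ n in atTop, ∀ x, |f n x - g x| ≤ δ) :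
    Tendsto (fun n => ∫ x, |f n (S n x) - g (S' x)| ∂(μ n)) atTop (𝓝 0) := by
  rw [Metric.tendsto_nhds]
  intro ε hε
  have hV := hg.pos
  have hgm := (hg.continuous hη).measurable
  obtain ⟨a, ha, haV⟩ : ∃ a : ℝ, 0 < a ∧ V * a ^ (η : ℝ) = ε / 4 := by
    refine ⟨(ε / (4 * V)) ^ (η : ℝ)⁻¹, by positivity, ?_⟩
    rw [Real.rpow_inv_rpow (by positivity) (by exact_mod_cast hη.ne')]
    field_simp
  have h1 := (hprob a ha).eventually_lt_const
    (show 0 < ENNReal.ofReal (ε / (8 * V)) from ENNReal.ofReal_pos.2 (by positivity))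
  filter_upwards [h1, hfg (ε / 4) (by positivity)] with n hn hn'
  have := hμ n
  -- As `Λ` is not assumed separable, the deviation set of the distance need not be measurable. `B`
  -- is a measurable subset of it, by the choice of `a`.
  set B : Set Λ := {x | ε / 4 < |g (S n x) - g (S' x)|}
  have hBm : MeasurableSet B := measurableSet_lt measurable_const
    ((hgm.comp (hS n)).sub (hgm.comp hS')).abs
  have hBs : B ⊆ {y | a < dist (S n y) (S' y)} := by
    intro x hx
    by_contra hxa
    refine absurd (show ε / 4 < |g (S n x) - g (S' x)| from hx) (not_lt.2 ?_)
    refine (hg.abs_sub_le _ _).trans ?_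
    rw [← haV]
    gcongr
    exact not_lt.1 hxa
  have hBμ : (μ n).real B ≤ ε / (8 * V) :=
    ENNReal.toReal_le_of_le_ofReal (by positivity) ((measure_mono hBs).trans hn.le)
  have hint : Integrable (fun x => ε / 2 + B.indicator (fun _ => 2 * V) x) (μ n) :=
    (integrable_const _).add ((integrable_const _).indicator hBm)
  have hle : ∫ x, |f n (S n x) - g (S' x)| ∂(μ n) ≤ ε / 2 + 2 * V * (ε / (8 * V)) :=
    calc _ ≤ ∫ x, (ε / 2 + B.indicator (fun _ => 2 * V) x) ∂(μ n) := by
          refine integral_mono_of_nonneg (.of_forall fun x => abs_nonneg _) hint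
            (.of_forall fun x => ?_)
          have h2 : |f n (S n x) - g (S' x)| ≤ ε / 4 + |g (S n x) - g (S' x)| := by
            rw [← sub_add_sub_cancel (f n (S n x)) (g (S n x)) (g (S' x))]
            exact (abs_add_le _ _).trans (by gcongr; exact hn' _)
          by_cases hx : x ∈ B
          · simp only [indicator_of_mem hx]
            have h3 := abs_sub (g (S n x)) (g (S' x))
            linarith [hg.abs_le (S n x), hg.abs_le (S' x)]
          · simp only [indicator_of_notMem hx]
            have : |g (S n x) - g (S' x)| ≤ ε / 4 := not_lt.1 hx
            linarith
      _ = ε / 2 + (μ n).real B * (2 * V) := by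
          rw [integral_add (integrable_const _) ((integrable_const _).indicator hBm),
            integral_indicator_const _ hBm]
          simp
      _ ≤ _ := by rw [mul_comm]; gcongr
  rw [Real.dist_0_eq_abs, abs_of_nonneg (integral_nonneg fun x => abs_nonneg _)]
  calc _ ≤ _ := hle
    _ = ε * (3 / 4) := by field_simp; ring
    _ < ε := by linarith

lemma tendsto_integral_corr (hη : 0 < η) {μ : ℕ → Measure Λ}
    (hμ : ∀ n, IsProbabilityMeasure (μ n)) {R S : ℕ → Λ → Λ} {R' S' : Λ → Λ}
    (hR : ∀ n, Measurable (R n)) (hR' : Measurable R')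
    (hS : ∀ n, Measurable (S n)) (hS' : Measurable S')
    (hprobR : ∀ a : ℝ, 0 < a →
      Tendsto (fun n => μ n {y | a < dist (R n y) (R' y)}) atTop (𝓝 0))
    (hprobS : ∀ a : ℝ, 0 < a →
      Tendsto (fun n => μ n {y | a < dist (S n y) (S' y)}) atTop (𝓝 0))
    {f f' : ℕ → Λ → ℝ} {g g' : Λ → ℝ} (hf : ∀ n, Measurable (f n)) (hf' : ∀ n, Measurable (f' n))
    (hg : HolderBound η V g) (hg' : HolderBound η V g')
    (hfg : ∀ δ : ℝ, 0 < δ → ∀ᶠ n in atTop, ∀ x, |f n x - g x| ≤ δ)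
    (hfg' : ∀ δ : ℝ, 0 < δ → ∀ᶠ n in atTop, ∀ x, |f' n x - g' x| ≤ δ) {L : ℝ}
    (hL : Tendsto (fun n => ∫ x, g (R' x) * g' (S' x) ∂(μ n)) atTop (𝓝 L)) :
    Tendsto (fun n => ∫ x, f n (R n x) * f' n (S n x) ∂(μ n)) atTop (𝓝 L) := by
  have hgm := (hg.continuous hη).measurable
  have hgm' := (hg'.continuous hη).measurable
  have h1 := tendsto_integral_abs_sub hη hμ hR hR' hprobR hg hfg
  have h2 := tendsto_integral_abs_sub hη hμ hS hS' hprobS hg' hfg'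
  have h3 := (h1.mul_const (V + 1)).add (h2.mul_const V)
  simp only [zero_mul, add_zero] at h3
  suffices h : Tendsto (fun n => ∫ x, f n (R n x) * f' n (S n x) ∂(μ n) -
      ∫ x, g (R' x) * g' (S' x) ∂(μ n)) atTop (𝓝 0) by
    simpa using h.add hL
  refine squeeze_zero_norm' ?_ h3
  filter_upwards [hfg 1 one_pos, hfg' 1 one_pos] with n hn hn'
  have := hμ n
  have hbd : ∀ {F G : Λ → ℝ} {c : ℝ}, (∀ x, |F x - G x| ≤ c) → (∀ x, |G x| ≤ V) →
      ∀ x, |F x| ≤ V + c := fun {F G c} h h' x => by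
    have := abs_add_le (F x - G x) (G x)
    rw [sub_add_cancel] at this
    linarith [h x, h' x]
  have hfb := hbd hn hg.abs_le
  have hfb' := hbd hn' hg'.abs_le
  have hV := hg.pos
  have hmR : Measurable fun x => f n (R n x) := (hf n).comp (hR n)
  have hmS : Measurable fun x => f' n (S n x) := (hf' n).comp (hS n)
  have hmR' : Measurable fun x => g (R' x) := hgm.comp hR'
  have hmS' : Measurable fun x => g' (S' x) := hgm'.comp hS'
  have hint : ∀ {F : Λ → ℝ} {c : ℝ}, Measurable F → (∀ x, |F x| ≤ c) → Integrable F (μ n) :=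
    fun {F c} hF h => (integrable_const c).mono' hF.aestronglyMeasurable (.of_forall h)
  have i1 : Integrable (fun x => f n (R n x) * f' n (S n x)) (μ n) :=
    hint (c := (V + 1) * (V + 1)) (hmR.mul hmS) fun x => by
      rw [abs_mul]; exact mul_le_mul (hfb _) (hfb' _) (abs_nonneg _) (by positivity)
  have i2 : Integrable (fun x => g (R' x) * g' (S' x)) (μ n) :=
    hint (c := V * V) (hmR'.mul hmS') fun x => by
      rw [abs_mul]; exact mul_le_mul (hg.abs_le _) (hg'.abs_le _) (abs_nonneg _) hV.le
  have i3 : Integrable (fun x => |f n (R n x) - g (R' x)|) (μ n) :=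
    ((hint hmR fun x => hfb _).sub (hint hmR' fun x => hg.abs_le _)).abs
  have i4 : Integrable (fun x => |f' n (S n x) - g' (S' x)|) (μ n) :=
    ((hint hmS fun x => hfb' _).sub (hint hmS' fun x => hg'.abs_le _)).abs
  rw [← integral_sub i1 i2, ← integral_mul_const, ← integral_mul_const,
    ← integral_add (i3.mul_const _) (i4.mul_const _)]
  refine norm_integral_le_of_norm_le ((i3.mul_const _).add (i4.mul_const _)) (.of_forall fun x => ?_)
  have hdec : f n (R n x) * f' n (S n x) - g (R' x) * g' (S' x) =
      (f n (R n x) - g (R' x)) * f' n (S n x) + (f' n (S n x) - g' (S' x)) * g (R' x) := by ring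
  rw [hdec]
  refine (norm_add_le _ _).trans ?_
  rw [norm_mul, norm_mul]
  simp only [Real.norm_eq_abs]
  gcongr
  · exact hfb' _
  · exact hg.abs_le _

/-- Interchange of limits. -/
lemma tendsto_of_uniform_approx {a : ℕ → ℕ → ℝ} {a' L : ℕ → ℝ} {L' : ℝ}
    (ha : ∀ k, Tendsto (a k) atTop (𝓝 (a' k)))
    (h : ∀ ε : ℝ, 0 < ε → ∃ k, (∀ᶠ n in atTop, |a k n - L n| ≤ ε) ∧ |a' k - L'| ≤ ε) :
    Tendsto L atTop (𝓝 L') := by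
  rw [Metric.tendsto_nhds]
  intro ε hε
  obtain ⟨k, hk, hk'⟩ := h (ε / 4) (by positivity)
  filter_upwards [hk, Metric.tendsto_nhds.1 (ha k) (ε / 4) (by positivity)] with n h1 h2
  rw [Real.dist_eq] at h2 ⊢
  have h3 : L n - L' = -(a k n - L n) + (a k n - a' k) + (a' k - L') := by ring
  rw [h3]
  refine (abs_add_three _ _ _).trans_lt ?_
  rw [abs_neg]
  linarith

end Limits

end NonuniformlyExpanding

end

/-! ### Existence of the limits and their continuity along the family. -/

theorem mainTheorem9 {Λ : Type*} [MetricSpace Λ] [BoundedSpace Λ] [MeasurableSpace Λ]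
    [BorelSpace Λ] (ρ : Measure Λ) [IsFiniteMeasure ρ]
    (T : ℕ∞ → Λ → Λ) (I : ℕ∞ → NonuniformlyExpanding.InducingScheme Λ)
    (μY : ℕ∞ → Measure Λ) (μ : ℕ∞ → ProbabilityMeasure Λ) (η : ℝ≥0) (p : ℝ) (hp : 2 < p)
    (hT : NonuniformlyExpanding.IsUniformFamily ρ T I μY (fun n => (μ n : Measure Λ)) η p)
    -- statistical stability
    (hstable : Tendsto (fun n : ℕ => μ (n : ℕ∞)) atTop (𝓝 (μ ⊤)))
    (hcorr : ∀ (j k : ℕ) (v w : Λ → ℝ),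
      NonuniformlyExpanding.IsHolder η v → NonuniformlyExpanding.IsHolder η w →
      Tendsto (fun n : ℕ => ∫ x, v ((T ⊤)^[j] x) * w ((T ⊤)^[k] x) ∂(μ (n : ℕ∞) : Measure Λ))
        atTop (𝓝 (∫ x, v ((T ⊤)^[j] x) * w ((T ⊤)^[k] x) ∂(μ ⊤ : Measure Λ))))
    (hprob : ∀ (j : ℕ) (a : ℝ), 0 < a →
      Tendsto (fun n : ℕ => (μ (n : ℕ∞) : Measure Λ)
          {y | a < dist ((T (n : ℕ∞))^[j] y) ((T ⊤)^[j] y)})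
        atTop (𝓝 0))
    (d : ℕ) (v : ℕ∞ → Λ → EuclideanSpace ℝ (Fin d))
    (hv : ∀ n, NonuniformlyExpanding.IsHolder η (v n))
    (hmean : ∀ n, ∫ x, v n x ∂(μ n : Measure Λ) = 0)
    (hlim : Tendsto
      (fun n : ℕ => NonuniformlyExpanding.holderNorm η (fun x => v (n : ℕ∞) x - v ⊤ x))
      atTop (𝓝 0)) :
    ∃ Sig E : ℕ∞ → Matrix (Fin d) (Fin d) ℝ,
      (∀ n, Tendsto
        (fun k : ℕ => NonuniformlyExpanding.meanSquare (μ n : Measure Λ) (T n) (v n) k)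
        atTop (𝓝 (Sig n))) ∧
      (∀ n, Tendsto
        (fun k : ℕ => NonuniformlyExpanding.meanIterated (μ n : Measure Λ) (T n) (v n) k)
        atTop (𝓝 (E n))) ∧
      Tendsto (fun n : ℕ => Sig (n : ℕ∞)) atTop (𝓝 (Sig ⊤)) ∧
      Tendsto (fun n : ℕ => E (n : ℕ∞)) atTop (𝓝 (E ⊤)) := by
  open NonuniformlyExpanding in
  obtain ⟨β, C₁, hE⟩ := hT.expanding
  have hη : 0 < η := (hE ⊤).η_pos
  have hTm : ∀ n, Measurable (T n) := fun n => (hE n).nonsingular.measurable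
  choose V hV using fun n => exists_holderBound (hv n)
  have hvm : ∀ n r, Measurable fun x => v n x r := fun n r => ((hV n r).continuous hη).measurable
  have hmean' : ∀ n r, ∫ x, v n x r ∂(μ n : Measure Λ) = 0 := fun n r => by
    rw [integral_component hη (hV n) r, hmean n]; rfl
  have hclose : ∀ δ : ℝ, 0 < δ →
      ∀ᶠ n : ℕ in atTop, ∀ r, HolderBound η δ fun x => v n x r - v ⊤ x r := by
    intro δ hδ
    filter_upwards [hlim.eventually_le_const (ENNReal.ofReal_pos.2 hδ)] with n hn r
    simpa using holderBound_component hδ hn r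
  let E : ℕ∞ → Matrix (Fin d) (Fin d) ℝ := fun n => Matrix.of fun r s =>
    greenKubo (T n) (I n) (μY n) (fun x => v n x r) fun x => v n x s
  let c : ℕ∞ → Matrix (Fin d) (Fin d) ℝ := fun n => Matrix.of fun r s =>
    ∫ x, v n x r * v n x s ∂(μ n : Measure Λ)
  have hrate : ∀ W ε : ℝ, 0 < W → 0 < ε → ∃ k₀ : ℕ, ∀ k ≥ k₀, ∀ n,
      (∀ r, HolderBound η W fun x => v n x r) →
      ∀ r s, |meanIterated (μ n : Measure Λ) (T n) (v n) k r s - E n r s| ≤ ε := by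
    intro W ε hW hε
    obtain ⟨k₀, hk₀⟩ := hT.exists_uniform_rate hp (fun n => inferInstance) hW hε
    refine ⟨k₀, fun k hk n hn r s => ?_⟩
    rw [meanIterated_apply hη (hTm n) hn]
    exact hk₀ k hk n (fun x => v n x r) (fun x => v n x s) (hn r) (hn s) (hmean' n r) (hmean' n s)
  have hlimE : ∀ n r s, Tendsto (fun k : ℕ =>
      meanIterated (μ n : Measure Λ) (T n) (v n) k r s) atTop (𝓝 (E n r s)) := by
    intro n r s
    rw [Metric.tendsto_atTop]
    intro ε hε
    obtain ⟨k₀, hk₀⟩ := hrate (V n) (ε / 2) (hV n r).pos (half_pos hε)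
    exact ⟨k₀, fun k hk => (hk₀ k hk n (hV n) r s).trans_lt (half_lt_self hε)⟩
  have hcorr' : ∀ i j r s, Tendsto (fun n : ℕ =>
      ∫ x, v n ((T n)^[i] x) r * v n ((T n)^[j] x) s ∂(μ n : Measure Λ)) atTop
      (𝓝 (∫ x, v ⊤ ((T ⊤)^[i] x) r * v ⊤ ((T ⊤)^[j] x) s ∂(μ ⊤ : Measure Λ))) := by
    intro i j r s
    have hc : ∀ r, ∀ δ : ℝ, 0 < δ → ∀ᶠ n : ℕ in atTop, ∀ x, |v n x r - v ⊤ x r| ≤ δ :=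
      fun r δ hδ => (hclose δ hδ).mono fun n hn => (hn r).abs_le
    exact tendsto_integral_corr hη (μ := fun n : ℕ => (μ n : Measure Λ)) (fun n => inferInstance)
      (fun n => (hTm n).iterate i) ((hTm ⊤).iterate i)
      (fun n => (hTm n).iterate j) ((hTm ⊤).iterate j) (hprob i) (hprob j)
      (f := fun n x => v n x r) (f' := fun n x => v n x s)
      (fun n => hvm n r) (fun n => hvm n s) (hV ⊤ r) (hV ⊤ s) (hc r) (hc s)
      (hcorr i j _ _ (hV ⊤ r).isHolder (hV ⊤ s).isHolder)
  have hlimn : ∀ r s, Tendsto (fun n : ℕ => E n r s) atTop (𝓝 (E ⊤ r s)) := by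
    intro r s
    refine tendsto_of_uniform_approx
      (a := fun k n => meanIterated (μ n : Measure Λ) (T n) (v n) k r s)
      (a' := fun k => meanIterated (μ ⊤ : Measure Λ) (T ⊤) (v ⊤) k r s) (fun k => ?_)
      fun ε hε => ?_
    · simp only [fun n => meanIterated_apply (μ := (μ n : Measure Λ)) hη (hTm n) (hV n)]
      exact (tendsto_finsetSum _ fun j _ => tendsto_finsetSum _ fun i _ =>
        hcorr' i j r s).const_mul _
    -- The bound `1 + V ⊤` serves `v ⊤` and all `v n` with `n` large, so a single `k` works for them
    -- together.
    · obtain ⟨k, hk⟩ := hrate (1 + V ⊤) ε (by linarith [(hV ⊤ r).pos]) hε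
      refine ⟨k, ?_, hk k le_rfl ⊤ (fun r => (hV ⊤ r).mono (by linarith)) r s⟩
      filter_upwards [hclose 1 one_pos] with n hn
      exact hk k le_rfl n (fun r => by simpa using (hn r).add (hV ⊤ r)) r s
  -- The square of a Birkhoff sum splits into its diagonal, which contributes exactly `c n` by
  -- invariance for `k > 0`, and two triangular sums, transposes of each other.
  refine ⟨fun n => c n + E n + (E n).transpose, E, fun n => ?_, fun n => ?_, ?_, ?_⟩
  · refine tendsto_pi_nhds.2 fun r => tendsto_pi_nhds.2 fun s => ?_
    simp only [fun k => meanSquare_apply (μ := (μ n : Measure Λ)) hη (hTm n) (hV n) k r s]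
    refine (Tendsto.add ?_ (hlimE n r s)).add (hlimE n s r)
    refine tendsto_const_nhds.congr' ?_
    filter_upwards [eventually_gt_atTop 0] with k hk
    obtain ⟨M, -, hM⟩ := hT.exists_second_moment hp
    have H := towerData (hE n) (hT.inducedMeasure n) (hM n).1
    have hinv : ∀ j, ∫ x, v n ((T n)^[j] x) r * v n ((T n)^[j] x) s ∂(μ n : Measure Λ) =
        c n r s := by
      intro j
      have hμn : IsProbabilityMeasure (μ n : Measure Λ) := inferInstance
      have hc : c n r s = ∫ x, v n x r * v n x s ∂(μ n : Measure Λ) := rfl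
      rw [hT.measure_eq n] at hμn hc ⊢
      rw [hc]
      exact H.integral_comp_iterate hμn (b := fun x => v n x r * v n x s) (W := V n * V n)
        ((hvm n r).mul (hvm n s)) (fun x => by
          rw [abs_mul]
          exact mul_le_mul ((hV n r).abs_le x) ((hV n s).abs_le x) (abs_nonneg _) (hV n r).pos.le) j
    have hk' : (k : ℝ) ≠ 0 := by exact_mod_cast hk.ne'
    simp only [hinv, Finset.sum_const, Finset.card_range, nsmul_eq_mul]
    rw [inv_mul_cancel_left₀ hk']
  · exact tendsto_pi_nhds.2 fun r => tendsto_pi_nhds.2 fun s => hlimE n r s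
  · refine tendsto_pi_nhds.2 fun r => tendsto_pi_nhds.2 fun s => ?_
    -- The diagonal term converges as the correlation at times `0`, `0`.
    exact ((hcorr' 0 0 r s).add (hlimn r s)).add (hlimn s r)
  · exact tendsto_pi_nhds.2 fun r => tendsto_pi_nhds.2 fun s => hlimn r s
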